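/- Let $X$ be a compact Hausdorff space. Let $P_f(X)$ be the set of all finitely supported probability measures $\mu=\sum_{i=1}^{n}m_i\delta_{x_i}$ on $X$ (with $n\ge 1$, $x_1,\dots,x_n$ distinct, all $m_i>0$ and $\sum_i m_i=1$) such that $m_{i_0}\ge 1-\frac{1}{n+1}$ for some index $i_0$. Give $P_f(X)$ the topology of weak convergence, i.e. the coarsest topology for which $\mu\mapsto\int\varphi\,d\mu$ is continuous for every continuous $\varphi:X\to\mathbb{R}$. Recall that a topological space $Z$ is an absolute neighbourhood retract (ANR) if it is metrizable and, whenever $Z$ is embedded as a closed subset of a metrizable space $Y$, there are an open set $U\subseteq Y$ containing the image $Z'$ of $Z$ and a continuous map $U\to Z'$ fixing every point of $Z'$. Then $P_f(X)$ is an ANR if and only if $X$ is an ANR. -/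

import Mathlib

open MeasureTheory Topology

/-- A subset `A` of a topological space `Y` is a neighbourhood retract of `Y`: some open set
`U` of `Y` containing `A` admits a retraction onto `A`, i.e. a continuous map `U → A` fixing every
point of `A`. (The values of `r` outside `U` play no role.) -/
def IsNeighborhoodRetract {Y : Type*} [TopologicalSpace Y] (A : Set Y) : Prop :=
  ∃ U : Set Y, IsOpen U ∧ A ⊆ U ∧
    ∃ r : Y → Y, ContinuousOn r U ∧ Set.MapsTo r U A ∧ ∀ a ∈ A, r a = a

/-- Absolute neighbourhood retracts in the sense of Borsuk: a metrizable space `X` such that,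
whenever `X` is embedded as a closed subset of a metrizable space `Y`, its image is a neighbourhood
retract of `Y`. -/
def IsANR.{u} (X : Type u) [TopologicalSpace X] : Prop :=
  TopologicalSpace.MetrizableSpace X ∧
    ∀ (Y : Type u) [TopologicalSpace Y] [TopologicalSpace.MetrizableSpace Y] (i : X → Y),
      IsClosedEmbedding i → IsNeighborhoodRetract (Set.range i)

/-- `HasFiniteSupport μ s`: the probability measure `μ` is finitely supported, with support
exactly `s = {x₁, …, xₙ}`; that is, `μ = ∑ mᵢ δ_{xᵢ}` with distinct `xᵢ` and all `mᵢ > 0`. -/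
def HasFiniteSupport {X : Type*} [MeasurableSpace X] (μ : ProbabilityMeasure X)
    (s : Finset X) : Prop :=
  μ (s : Set X)ᶜ = 0 ∧ ∀ x ∈ s, 0 < μ {x}

/-- The set `P_f(X)` of finitely supported probability measures such that, when the
support has `n` points, some point of it has mass at least `1 - 1 / (n + 1)`. As a space it carries
the topology induced by the weak topology of `ProbabilityMeasure X`. -/
def Pf (X : Type*) [MeasurableSpace X] : Set (ProbabilityMeasure X) :=
  {μ | ∃ s : Finset X, HasFiniteSupport μ s ∧
    ∃ x ∈ s, (1 : ℝ) - 1 / ((s.card : ℝ) + 1) ≤ (μ {x} : ℝ)}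

/-!
Write `ctr μ` for the point of `μ ∈ Pf X` of mass greater than `1 / 2`. It depends continuously on
`μ`, so `X` is a retract of `Pf X` by way of the point masses. Moreover `Pf X` is compact: measures in
`Pf X` with many points are close to point masses. For compact metrizable spaces, being an ANR is
the same as the neighbourhood extension property for closed subsets of metrizable spaces (embed in
`ℕ → ℝ` and use the Tietze theorem), which passes to retracts; hence `X` is an ANR if `Pf X` is one.

For the converse, the flexibility comes from the operation `Pf.mix`: mass may be moved to the centre
and points may be moved or merged without leaving `Pf`. If `X` is a neighbourhood retract of the
Hilbert cube, then for this reason extensions of maps into `Pf X` can be obtained from extensions of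
maps into `Pf Cube` (`isANE_Pf`). That `Pf Cube` is an absolute extensor is proved in two steps.

* An arbitrarily small homotopy moves `Pf Cube` into the subspaces `PfFace n` of measures carried by
  at most `n` points of an `n`-dimensional face (`exists_homotopy_Pf_cube`); by an argument of Hanner
  (`isAE_of_homotopy`) it suffices that these are absolute extensors.
* `PfFace n` is compact, contractible, locally contractible (`hasLocalContractions_PfFace`), and embeds
  in a Euclidean space by finitely many moments (`exists_embedding_PfFace`). By a theorem of Borsuk
  (`isNeighborhoodRetract_of_hasLocalContractions`), a compact locally contractible subset of a
  Euclidean space is a neighbourhood retract; here this is proved with a finitely coloured Whitney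
  decomposition of the complement, extending the retraction over one colour at a time.
-/

/-! ### Extension properties and neighbourhood retracts -/

/-- Absolute neighbourhood extensors for metrizable spaces: every continuous map into `Z` from a
closed subset `A` of a metrizable space extends to a neighbourhood of `A`. Partial maps are total
functions that are continuous on `A`. -/
def IsANE.{u, v} (Z : Type v) [TopologicalSpace Z] : Prop :=
  ∀ (Y : Type u) [TopologicalSpace Y] [TopologicalSpace.MetrizableSpace Y] (A : Set Y),
    IsClosed A → ∀ f : Y → Z, ContinuousOn f A →
      ∃ U : Set Y, IsOpen U ∧ A ⊆ U ∧ ∃ g : Y → Z, ContinuousOn g U ∧ Set.EqOn g f A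

/-- Absolute extensors for metrizable spaces: every continuous map into `Z` from a closed subset of
a metrizable space extends to the whole space. -/
def IsAE.{u, v} (Z : Type v) [TopologicalSpace Z] : Prop :=
  ∀ (Y : Type u) [TopologicalSpace Y] [TopologicalSpace.MetrizableSpace Y] (A : Set Y),
    IsClosed A → ∀ f : Y → Z, ContinuousOn f A → ∃ g : Y → Z, Continuous g ∧ Set.EqOn g f A

theorem IsANE.isANR.{u} {Z : Type u} [TopologicalSpace Z] [TopologicalSpace.MetrizableSpace Z]
    (h : IsANE.{u} Z) : IsANR Z := by
  refine ⟨inferInstance, fun Y _ _ i hi ↦ ?_⟩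
  rcases isEmpty_or_nonempty Z with hZ | hZ
  · exact ⟨∅, isOpen_empty, by simp [Set.range_eq_empty], id, by simp, by simp [Set.MapsTo],
      fun _ _ ↦ rfl⟩
  have hinv : ∀ z, Function.invFun i (i z) = z := Function.leftInverse_invFun hi.injective
  have hcont : ContinuousOn (Function.invFun i) (Set.range i) := by
    rw [hi.isEmbedding.continuousOn_iff]
    exact continuousOn_id.congr fun y hy ↦ Function.invFun_eq hy
  obtain ⟨U, hU, hAU, g, hg, hgf⟩ := h Y (Set.range i) hi.isClosed_range _ hcont
  refine ⟨U, hU, hAU, i ∘ g, hi.continuous.comp_continuousOn hg, fun _ _ ↦ ⟨_, rfl⟩, ?_⟩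
  rintro _ ⟨z, rfl⟩
  simp [hgf ⟨z, rfl⟩, hinv]

theorem exists_continuous_extension_of_tietze.{u, v} {Y : Type u} [TopologicalSpace Y]
    [NormalSpace Y] {E : Type v} [TopologicalSpace E] [TietzeExtension.{u, v} E] {A : Set Y}
    (hA : IsClosed A) {f : Y → E} (hf : ContinuousOn f A) :
    ∃ g : Y → E, Continuous g ∧ Set.EqOn g f A := by
  obtain ⟨g, hg⟩ := ContinuousMap.exists_restrict_eq hA ⟨A.domRestrict f, hf.domRestrict⟩
  exact ⟨g, g.continuous, fun a ha ↦ congrArg (fun k : C(A, E) ↦ k ⟨a, ha⟩) hg⟩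

theorem isANE_of_isEmbedding_of_isNeighborhoodRetract.{u, v, w} {Z : Type v} {E : Type w}
    [TopologicalSpace Z] [TopologicalSpace E] [TietzeExtension.{u, w} E] {i : Z → E}
    (hi : IsEmbedding i) (hr : IsNeighborhoodRetract (Set.range i)) : IsANE.{u} Z := by
  intro Y _ _ A hA f hf
  rcases isEmpty_or_nonempty Z with hZ | hZ
  · exact ⟨∅, isOpen_empty, fun y _ ↦ hZ.elim (f y), f, by simp, fun _ _ ↦ rfl⟩
  obtain ⟨U, hU, hAU, r, hr, hrm, hrA⟩ := hr
  obtain ⟨F, hF, hFf⟩ := exists_continuous_extension_of_tietze (E := E) hA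
    (hi.continuous.comp_continuousOn hf)
  have key : ∀ x ∈ U, i (Function.invFun i (r x)) = r x := fun x hx ↦
    Function.invFun_eq (hrm hx)
  refine ⟨F ⁻¹' U, hU.preimage hF, fun a ha ↦ ?_, fun y ↦ Function.invFun i (r (F y)), ?_, ?_⟩
  · rw [Set.mem_preimage, hFf ha]
    exact hAU ⟨_, rfl⟩
  · rw [hi.continuousOn_iff]
    refine (hr.comp hF.continuousOn fun y hy ↦ hy).congr fun y hy ↦ key _ hy
  · intro a ha
    apply hi.injective
    have : F a ∈ U := by rw [hFf ha]; exact hAU ⟨_, rfl⟩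
    rw [key _ this, hFf ha]
    exact hrA _ ⟨_, rfl⟩

/-- A compact ANR is closed in a copy of `ℕ → ℝ`, a space with the Tietze extension property, so a
neighbourhood retraction there turns Tietze extensions into neighbourhood extensions. -/
theorem IsANR.isANE_of_compactSpace.{u} {Z : Type u} [TopologicalSpace Z] [CompactSpace Z]
    (h : IsANR Z) : IsANE.{u} Z := by
  obtain ⟨hm, hr⟩ := h
  let := TopologicalSpace.metrizableSpaceMetric Z
  obtain ⟨F, hF⟩ := Metric.PiNatEmbed.exists_embedding_to_hilbert_cube (X := Z)
  have hj : Continuous fun z n ↦ (F z n : ℝ) := by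
    have := hF.continuous
    fun_prop
  let i : Z → ULift.{u} (ℕ → ℝ) := fun z ↦ ⟨fun n ↦ (F z n : ℝ)⟩
  have hi : IsClosedEmbedding i := by
    refine Continuous.isClosedEmbedding (continuous_uliftUp.comp hj) fun z w hzw ↦ ?_
    apply hF.injective
    funext n
    exact Subtype.ext (congrFun (congrArg ULift.down hzw) n)
  have : TietzeExtension.{u, u} (ULift.{u} (ℕ → ℝ)) := TietzeExtension.of_homeo Homeomorph.ulift
  have : TopologicalSpace.MetrizableSpace (ULift.{u} (ℕ → ℝ)) :=
    Homeomorph.ulift.isEmbedding.metrizableSpace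
  exact isANE_of_isEmbedding_of_isNeighborhoodRetract hi.isEmbedding (hr _ i hi)

/-- Far from `A` a neighbourhood extension can be pushed along a contraction to a constant, and
then continued by that constant. -/
theorem IsANE.isAE_of_contractibleSpace.{u, v} {Z : Type v} [TopologicalSpace Z]
    [ContractibleSpace Z] (h : IsANE.{u} Z) : IsAE.{u} Z := by
  intro Y _ _ A hA f hf
  obtain ⟨U, hU, hAU, g, hg, hgf⟩ := h Y A hA f hf
  obtain ⟨z₀, ⟨H⟩⟩ := id_nullhomotopic Z
  obtain ⟨V, hV, hAV, hVU⟩ := normal_exists_closure_subset hA hU hAU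
  obtain ⟨u, hu0, hu1, hu⟩ := exists_continuous_zero_one_of_isClosed hA hV.isClosed_compl
    (Set.disjoint_compl_right_iff_subset.2 hAV)
  let u' : Y → unitInterval := fun y ↦ ⟨u y, hu y⟩
  have hu' : Continuous u' := by fun_prop
  classical
  refine ⟨fun y ↦ if y ∈ U then H (u' y, g y) else z₀, ?_, ?_⟩
  · rw [continuous_iff_continuousAt]
    intro y
    by_cases hy : y ∈ U
    · have : ContinuousAt (fun y ↦ H (u' y, g y)) y :=
        H.continuous.continuousAt.comp (hu'.continuousAt.prodMk (hg.continuousAt (hU.mem_nhds hy)))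
      refine this.congr ?_
      filter_upwards [hU.mem_nhds hy] with x hx
      simp [hx]
    · refine (continuousAt_const (y := z₀)).congr ?_
      filter_upwards [isClosed_closure.isOpen_compl.mem_nhds (fun h' ↦ hy (hVU h'))] with x hx
      split_ifs with hxU
      · have : u' x = 1 := Subtype.ext (hu1 fun h' ↦ hx (subset_closure h'))
        rw [this]
        simp
      · rfl
  · intro a ha
    have : u' a = 0 := Subtype.ext (hu0 ha)
    simp only [hAU ha, if_true, this]
    simpa using hgf ha

/-! ### Spaces deformable into absolute extensors -/

/-- The homotopy `(a, s) ↦ h s (f a)`, given on `A × (0, ∞)`, is extended to `Y × (0, ∞)` scale by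
scale: `G k` is an extension for the times `s ≥ 2⁻ᵏ`, and `G (k + 1)` agrees with `G k` there. -/
theorem exists_stages.{u, v} {Y : Type u} [TopologicalSpace Y]
    [TopologicalSpace.MetrizableSpace Y] {Z : Type v} [TopologicalSpace Z]
    {S : ℕ → Set Z} (hmono : Monotone S) (hS : ∀ k, IsAE.{u} (S k))
    {h : ℝ → Z → Z} (hh : Continuous (Function.uncurry h))
    (hhS : ∀ k s z, (1 / 2 : ℝ) ^ k ≤ s → h s z ∈ S k)
    {A : Set Y} (hA : IsClosed A) {f : Y → Z} (hf : ContinuousOn f A) :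
    ∃ G : ℕ → Y → ℝ → Z, (∀ k, Continuous (Function.uncurry (G k))) ∧
      (∀ k, ∀ a ∈ A, ∀ s, (1 / 2 : ℝ) ^ k ≤ s → G k a s = h s (f a)) ∧
      ∀ k y s, (1 / 2 : ℝ) ^ k ≤ s → G (k + 1) y s = G k y s := by
  have key : ∀ (k : ℕ) (B : Set (Y × ℝ)), IsClosed B → ∀ g : Y × ℝ → Z, ContinuousOn g B →
      (∀ p ∈ B, g p ∈ S k) →
      ∃ G : Y × ℝ → Z, Continuous G ∧ (∀ p, G p ∈ S k) ∧ Set.EqOn G g B := by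
    intro k B hB g hg hgS
    rcases B.eq_empty_or_nonempty with rfl | ⟨b, hb⟩
    · rcases isEmpty_or_nonempty Y with hY | ⟨⟨y⟩⟩
      · exact ⟨g, continuous_of_const fun p ↦ hY.elim p.1, fun p ↦ hY.elim p.1, fun _ _ ↦ rfl⟩
      · let z := h 1 (f y)
        have hz : z ∈ S k := hmono (Nat.zero_le k) (hhS 0 1 _ (by norm_num))
        exact ⟨fun _ ↦ z, continuous_const, fun _ ↦ hz, fun _ h ↦ h.elim⟩
    · classical
      let g' : Y × ℝ → S k := fun p ↦ if hp : p ∈ B then ⟨g p, hgS p hp⟩ else ⟨g b, hgS b hb⟩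
      have hg' : ∀ p ∈ B, (g' p : Z) = g p := fun p hp ↦ by simp [g', hp]
      obtain ⟨G, hG, hGg⟩ := hS k (Y × ℝ) B hB g' (by
        rw [IsEmbedding.subtypeVal.continuousOn_iff]
        exact hg.congr hg')
      exact ⟨fun p ↦ G p, continuous_subtype_val.comp hG, fun p ↦ (G p).2, fun p hp ↦ by
        simp only [hGg hp, hg' p hp]⟩
  let T : ℕ → Set (Y × ℝ) := fun k ↦ {p | (1 / 2 : ℝ) ^ k ≤ p.2}
  have hT : ∀ k, IsClosed (T k) := fun k ↦ isClosed_le continuous_const continuous_snd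
  have hAT : ∀ k, IsClosed (Prod.fst ⁻¹' A ∩ T k) := fun k ↦
    (hA.preimage continuous_fst).inter (hT k)
  have hhf : ContinuousOn (fun p : Y × ℝ ↦ h p.2 (f p.1)) (Prod.fst ⁻¹' A) :=
    hh.comp_continuousOn (continuousOn_snd.prodMk (hf.comp continuousOn_fst fun p hp ↦ hp))
  let P : ℕ → (Y × ℝ → Z) → Prop := fun k G ↦ Continuous G ∧ (∀ p, G p ∈ S k) ∧
    ∀ p ∈ Prod.fst ⁻¹' A ∩ T k, G p = h p.2 (f p.1)
  have h0 : ∃ G, P 0 G := by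
    obtain ⟨G, hG, hGS, hGf⟩ := key 0 _ (hAT 0) _ (hhf.mono Set.inter_subset_left)
      (fun p hp ↦ hhS 0 _ _ hp.2)
    exact ⟨G, hG, hGS, hGf⟩
  have hstep : ∀ k G, P k G → ∃ G', P (k + 1) G' ∧ Set.EqOn G' G (T k) := by
    rintro k G ⟨hG, hGS, hGf⟩
    classical
    let g : Y × ℝ → Z := fun p ↦ if p ∈ T k then G p else h p.2 (f p.1)
    have hgT : Set.EqOn g G (T k) := fun p hp ↦ by simp [g, hp]
    have hgA : Set.EqOn g (fun p ↦ h p.2 (f p.1)) (Prod.fst ⁻¹' A ∩ T (k + 1)) := by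
      intro p hp
      by_cases hpT : p ∈ T k
      · simp [g, hpT, hGf p ⟨hp.1, hpT⟩]
      · simp [g, hpT]
    obtain ⟨G', hG', hGS', hGf'⟩ := key (k + 1) (T k ∪ (Prod.fst ⁻¹' A ∩ T (k + 1)))
      ((hT k).union (hAT _)) g
      ((hG.continuousOn.congr hgT).union_of_isClosed
        ((hhf.mono Set.inter_subset_left).congr hgA) (hT k) (hAT _))
      (by
        rintro p (hp | hp)
        · rw [hgT hp]
          exact hmono (Nat.le_succ k) (hGS p)
        · rw [hgA hp]
          exact hhS _ _ _ hp.2)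
    exact ⟨G', ⟨hG', hGS', fun p hp ↦ (hGf' (Or.inr hp)).trans (hgA hp)⟩,
      fun p hp ↦ (hGf' (Or.inl hp)).trans (hgT hp)⟩
  obtain ⟨G₀, hG₀⟩ := h0
  choose! nxt hnxt hnxt' using hstep
  let G : ℕ → Y × ℝ → Z := fun k ↦ Nat.rec G₀ nxt k
  have hP : ∀ k, P k (G k) := fun k ↦ by
    induction k with
    | zero => exact hG₀
    | succ k ih => exact hnxt k _ ih
  exact ⟨fun k y s ↦ G k (y, s), fun k ↦ (hP k).1, fun k a ha s hs ↦ (hP k).2.2 (a, s) ⟨ha, hs⟩,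
    fun k y s hs ↦ hnxt' k _ (hP k) (show (y, s) ∈ T k from hs)⟩

/-- A metrizable space which deforms, by an arbitrarily small homotopy, into absolute extensors is
itself an absolute extensor. The extension of `f` is `y ↦ G (y, τ y)`, where `G` extends the
homotopy over `Y × (0, ∞)` and `τ` vanishes exactly on `A`; it is continuous at `A` provided that
`τ y` is not too small in terms of how well `G (y, ·)` follows the homotopy at nearby points
of `A`. -/
theorem isAE_of_homotopy.{u, v} {Z : Type v} [TopologicalSpace Z]
    [TopologicalSpace.MetrizableSpace Z]
    {S : ℕ → Set Z} (hmono : Monotone S) (hS : ∀ k, IsAE.{u} (S k))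
    {h : ℝ → Z → Z} (hh : Continuous (Function.uncurry h)) (h0 : ∀ z, h 0 z = z)
    (hhS : ∀ k s z, (1 / 2 : ℝ) ^ k ≤ s → h s z ∈ S k) : IsAE.{u} Z := by
  intro Y _ _ A hA f hf
  obtain ⟨G, hG, hGf, hGG⟩ := exists_stages hmono hS hh hhS hA hf
  rcases A.eq_empty_or_nonempty with rfl | hAne
  · exact ⟨fun y ↦ G 0 y 1, (hG 0).comp (by fun_prop : Continuous fun y : Y ↦ (y, (1 : ℝ))),
      fun _ h ↦ h.elim⟩
  let := TopologicalSpace.metrizableSpaceMetric Y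
  let := TopologicalSpace.metrizableSpaceMetric Z
  have hpos : ∀ k : ℕ, (0 : ℝ) < (1 / 2) ^ k := fun k ↦ by positivity
  have hGle : ∀ k m, k ≤ m → ∀ y s, (1 / 2 : ℝ) ^ k ≤ s → G m y s = G k y s := by
    intro k m hkm y s hs
    induction m, hkm using Nat.le_induction with
    | base => rfl
    | succ m hkm ih =>
      rw [hGG m y s ((pow_le_pow_of_le_one (by norm_num) (by norm_num) hkm).trans hs), ih]
  -- `O k`: points at which the stage `k` is `2⁻ᵏ`-close to the prescribed homotopy
  let O : ℕ → Set Y := fun k ↦ {y | ∃ a ∈ A, dist y a < (1 / 2) ^ k ∧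
    ∀ s ∈ Set.Icc ((1 / 2 : ℝ) ^ k) 1, dist (G k y s) (h s (f a)) < (1 / 2) ^ k}
  have hO : ∀ k, A ⊆ interior (O k) := by
    intro k a ha
    rw [mem_interior_iff_mem_nhds]
    have hev : ∀ᶠ y in 𝓝 a, ∀ s ∈ Set.Icc ((1 / 2 : ℝ) ^ k) 1,
        dist (G k y s) (h s (f a)) < (1 / 2) ^ k := by
      refine isCompact_Icc.eventually_forall_of_forall_eventually fun s hs ↦ ?_
      have hc : Continuous fun p : Y × ℝ ↦ dist (G k p.1 p.2) (h p.2 (f a)) :=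
        (hG k).dist (hh.comp (by fun_prop : Continuous fun p : Y × ℝ ↦ (p.2, f a)))
      refine hc.continuousAt.eventually_lt continuousAt_const ?_
      simp [hGf k a ha s hs.1]
    filter_upwards [hev, Metric.ball_mem_nhds a (hpos k)] with y hy hya
    exact ⟨a, ha, hya, hy⟩
  have hu : ∀ k, ∃ u : C(Y, ℝ), Set.EqOn u 0 A ∧ Set.EqOn u 1 (interior (O k))ᶜ ∧
      ∀ y, u y ∈ Set.Icc (0 : ℝ) 1 := fun k ↦
    exists_continuous_zero_one_of_isClosed hA isOpen_interior.isClosed_compl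
      (Set.disjoint_compl_right_iff_subset.2 (hO k))
  choose u hu0 hu1 hu using hu
  have hsum : Summable fun k : ℕ ↦ 2 * (1 / 2 : ℝ) ^ k :=
    (summable_geometric_of_lt_one (by norm_num) (by norm_num)).mul_left 2
  have hle : ∀ k y, 2 * (1 / 2 : ℝ) ^ k * u k y ≤ 2 * (1 / 2) ^ k := fun k y ↦
    mul_le_of_le_one_right (by positivity) (hu k y).2
  have hnn : ∀ k y, 0 ≤ 2 * (1 / 2 : ℝ) ^ k * u k y := fun k y ↦
    mul_nonneg (by positivity) (hu k y).1
  have hsumy : ∀ y, Summable fun k ↦ 2 * (1 / 2 : ℝ) ^ k * u k y := fun y ↦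
    Summable.of_nonneg_of_le (fun k ↦ hnn k y) (fun k ↦ hle k y) hsum
  let τ : Y → ℝ := fun y ↦ Metric.infDist y A + ∑' k, 2 * (1 / 2 : ℝ) ^ k * u k y
  have hτ : Continuous τ := by
    refine (Metric.continuous_infDist_pt A).add (continuous_tsum (fun k ↦ by fun_prop) hsum
      fun k y ↦ ?_)
    rw [Real.norm_of_nonneg (hnn k y)]
    exact hle k y
  have hτA : ∀ a ∈ A, τ a = 0 := by
    intro a ha
    have : ∀ k, u k a = 0 := fun k ↦ hu0 k ha
    simp [τ, this, Metric.infDist_zero_of_mem ha]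
  have hτpos : ∀ y ∉ A, 0 < τ y := fun y hy ↦ add_pos_of_pos_of_nonneg
    ((hA.notMem_iff_infDist_pos hAne).1 hy) (tsum_nonneg fun k ↦ hnn k y)
  have hτO : ∀ k y, τ y < 2 * (1 / 2) ^ k → y ∈ O k := by
    intro k y hy
    by_contra hyO
    have h1 : u k y = 1 := hu1 k fun h' ↦ hyO (interior_subset h')
    have h2 := (hsumy y).le_tsum k fun j _ ↦ hnn j y
    rw [h1, mul_one] at h2
    exact absurd (hy.trans_le h2) (not_lt.2 (le_add_of_nonneg_left Metric.infDist_nonneg))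
  have hex : ∀ y ∉ A, ∃ k : ℕ, (1 / 2 : ℝ) ^ k ≤ τ y := fun y hy ↦
    (exists_pow_lt_of_lt_one (hτpos y hy) (by norm_num)).imp fun _ h ↦ h.le
  classical
  let F : Y → Z := fun y ↦ if hy : y ∈ A then f y else G (Nat.find (hex y hy)) y (τ y)
  have hFA : ∀ a ∈ A, F a = f a := fun a ha ↦ by simp [F, ha]
  refine ⟨F, continuous_iff_continuousAt.2 fun y ↦ ?_, hFA⟩
  by_cases hy : y ∈ A
  · -- near `A` the value is close to the homotopy at a small time
    rw [ContinuousAt, hFA y hy]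
    have hc : ContinuousWithinAt (fun p : ℝ × Y ↦ h p.1 (f p.2)) (Set.univ ×ˢ A) (0, y) :=
      hh.continuousAt.comp_continuousWithinAt (continuousWithinAt_fst.prodMk
        ((hf y hy).comp continuousWithinAt_snd fun p hp ↦ hp.2))
    rw [Metric.tendsto_nhds]
    intro ε hε
    obtain ⟨δ, hδ, hδh⟩ := Metric.continuousWithinAt_iff.1 hc (ε / 2) (by positivity)
    have e1 : ∀ᶠ x in 𝓝 y, τ x < min 1 (min (ε / 2) (δ / 2)) :=
      hτ.continuousAt.eventually_lt continuousAt_const (by rw [hτA y hy]; positivity)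
    filter_upwards [e1, Metric.ball_mem_nhds y (half_pos hδ)] with x hx hxy
    rw [lt_min_iff, lt_min_iff] at hx
    by_cases hxA : x ∈ A
    · have := hδh (x := (0, x)) ⟨trivial, hxA⟩ (by
        rw [Prod.dist_eq, dist_self]
        exact max_lt hδ (hxy.trans (half_lt_self hδ)))
      simp only [h0] at this
      rw [hFA x hxA]
      linarith
    · set k := Nat.find (hex x hxA) with hk
      have hkle : (1 / 2 : ℝ) ^ k ≤ τ x := Nat.find_spec (hex x hxA)
      have hk0 : k ≠ 0 := fun h' ↦ by
        rw [h', pow_zero] at hkle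
        linarith
      have hlt : τ x < 2 * (1 / 2) ^ k := by
        obtain ⟨m, hm⟩ := Nat.exists_eq_succ_of_ne_zero hk0
        have := Nat.find_min (hex x hxA) (m := m) (by omega)
        rw [hm, pow_succ]
        linarith
      obtain ⟨a, ha, hxa, hcl⟩ := hτO k x hlt
      have h1 := hcl (τ x) ⟨hkle, hx.1.le⟩
      have h2 := hδh (x := (τ x, a)) ⟨trivial, ha⟩ (by
        rw [Prod.dist_eq, max_lt_iff]
        constructor
        · rw [Real.dist_eq, sub_zero, abs_of_pos (hτpos x hxA)]
          linarith
        · have := dist_triangle_left a y x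
          have h3 : dist x y < δ / 2 := hxy
          simp only at this ⊢
          linarith)
      simp only [h0] at h2
      have h3 : F x = G k x (τ x) := by simp [F, hxA, hk]
      rw [h3]
      calc dist (G k x (τ x)) (f y) ≤ _ := dist_triangle _ (h (τ x) (f a)) _
        _ < ε := by linarith
  · obtain ⟨k, hk⟩ := exists_pow_lt_of_lt_one (hτpos y hy) (y := (1 / 2 : ℝ)) (by norm_num)
    have : ContinuousAt (fun x ↦ G k x (τ x)) y :=
      ((hG k).comp (continuous_id.prodMk hτ)).continuousAt
    refine this.congr ?_
    filter_upwards [hA.isOpen_compl.mem_nhds hy, hτ.continuousAt.eventually_const_lt hk]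
      with x hxA hx
    have hxA' : x ∉ A := hxA
    have h3 : F x = G (Nat.find (hex x hxA')) x (τ x) := by simp [F, hxA']
    rw [h3]
    exact hGle _ _ (Nat.find_min' _ hx.le) _ _ (Nat.find_spec (hex x hxA'))

/-! ### Extension of partial retractions over a colour of cells -/

/-- Every point `z` has a neighbourhood that contracts inside `Z` to `z`, with `z` fixed throughout.
The time parameter is a real number so that no subtype is needed; only `[0, 1]` matters. -/
def HasLocalContractions (Z : Type*) [TopologicalSpace Z] : Prop :=
  ∀ z : Z, ∃ V ∈ 𝓝 z, ∃ H : Z → ℝ → Z,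
    ContinuousOn (Function.uncurry H) (V ×ˢ Set.univ) ∧
    (∀ w ∈ V, H w 0 = w) ∧ (∀ w ∈ V, H w 1 = z) ∧ ∀ t, H z t = z

/-- `H` contracts the subset `S` to the point `c` inside `Z`, moving no point by `ε` or more. -/
structure IsSmallContraction {Z : Type*} [MetricSpace Z] (S : Set Z) (ε : ℝ) (H : Z → ℝ → Z)
    (c : Z) : Prop where
  continuousOn : ContinuousOn (Function.uncurry H) (S ×ˢ Set.univ)
  map_zero : ∀ w ∈ S, H w 0 = w
  map_one : ∀ w ∈ S, H w 1 = c
  dist_lt : ∀ w ∈ S, ∀ t ∈ Set.Icc (0 : ℝ) 1, dist (H w t) w < ε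

theorem IsSmallContraction.mono {Z : Type*} [MetricSpace Z] {S : Set Z} {ε ε' : ℝ}
    {H : Z → ℝ → Z} {c : Z} (h : IsSmallContraction S ε H c) (hε : ε ≤ ε') :
    IsSmallContraction S ε' H c :=
  ⟨h.continuousOn, h.map_zero, h.map_one, fun w hw t ht ↦ (h.dist_lt w hw t ht).trans_le hε⟩

/-- Sets of small diameter contract by small moves, uniformly over the space. -/
def HasUniformContractions (Z : Type*) [MetricSpace Z] : Prop :=
  ∀ ε > 0, ∃ δ > 0, ∀ S : Set Z, S.Nonempty → (∀ w ∈ S, ∀ w' ∈ S, dist w w' < δ) →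
    ∃ H c, IsSmallContraction S ε H c

theorem HasLocalContractions.hasUniformContractions {Z : Type*} [MetricSpace Z] [CompactSpace Z]
    (h : HasLocalContractions Z) : HasUniformContractions Z := by
  intro ε hε
  choose V hV H hc h0 h1 hz using h
  let O : Z → Set Z := fun z ↦ interior (V z ∩ {w | ∀ t ∈ Set.Icc (0 : ℝ) 1,
    dist (H z w t) z < ε / 2})
  have hO : ∀ z, z ∈ O z := by
    intro z
    rw [mem_interior_iff_mem_nhds]
    refine Filter.inter_mem (hV z) ?_
    refine isCompact_Icc.eventually_forall_of_forall_eventually fun s hs ↦ ?_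
    have hcs : ContinuousAt (Function.uncurry (H z)) (z, s) :=
      (hc z).continuousAt (prod_mem_nhds (hV z) Filter.univ_mem)
    have : ContinuousAt (fun p ↦ dist (Function.uncurry (H z) p) z) (z, s) :=
      hcs.dist continuousAt_const
    refine this.eventually_lt continuousAt_const ?_
    simp [hz, half_pos hε]
  obtain ⟨δ, hδ, hδO⟩ := lebesgue_number_lemma_of_metric isCompact_univ
    (fun z ↦ isOpen_interior (s := V z ∩ {w | ∀ t ∈ Set.Icc (0 : ℝ) 1,
      dist (H z w t) z < ε / 2})) (fun z _ ↦ Set.mem_iUnion.2 ⟨z, hO z⟩)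
  refine ⟨δ, hδ, fun S ⟨w₀, hw₀⟩ hS ↦ ?_⟩
  obtain ⟨z, hz'⟩ := hδO w₀ trivial
  have hSV : ∀ w ∈ S, w ∈ V z ∧ ∀ t ∈ Set.Icc (0 : ℝ) 1, dist (H z w t) z < ε / 2 :=
    fun w hw ↦ by
      have : w ∈ O z := hz' (hS w hw w₀ hw₀)
      have h2 := interior_subset this
      exact h2
  refine ⟨H z, z, (hc z).mono (Set.prod_mono (fun w hw ↦ (hSV w hw).1) subset_rfl),
    fun w hw ↦ h0 z w (hSV w hw).1, fun w hw ↦ h1 z w (hSV w hw).1, fun w hw t ht ↦ ?_⟩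
  have e0 := (hSV w hw).2 0 (by simp)
  rw [h0 z w (hSV w hw).1] at e0
  have := dist_triangle_right (H z w t) w z
  have := (hSV w hw).2 t ht
  linarith

theorem HasLocalContractions.of_homeomorph {Z Z' : Type*} [TopologicalSpace Z]
    [TopologicalSpace Z'] (h : HasLocalContractions Z) (e : Z ≃ₜ Z') :
    HasLocalContractions Z' := by
  intro z
  obtain ⟨V, hV, H, hc, h0, h1, hz⟩ := h (e.symm z)
  refine ⟨e.symm ⁻¹' V, e.symm.continuous.continuousAt.preimage_mem_nhds hV,
    fun w t ↦ e (H (e.symm w) t), ?_, fun w hw ↦ by simp [h0 _ hw], fun w hw ↦ by simp [h1 _ hw],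
    fun t ↦ by simp [hz]⟩
  have : Continuous fun p : Z' × ℝ ↦ (e.symm p.1, p.2) := by fun_prop
  exact e.continuous.comp_continuousOn (hc.comp this.continuousOn fun p hp ↦ ⟨hp.1, trivial⟩)

section CellFamily

variable {E : Type*} [MetricSpace E]

/-- One colour of a Whitney-type decomposition of the complement of `K`. The cells are the sets
`{y ∈ W | idx y = i}`; they are pairwise disjoint and, `idx` being locally constant on `W`, open.
Cells near `K` are small. The closed (in `Kᶜ`) subset `D` is the part of `W` which the colour is
responsible for covering, and `u` is a bump function equal to `1` on `D` that vanishes near every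
point of `Kᶜ` outside `W`. -/
structure CellFamily (K : Set E) (ι : Type*) where
  idx : E → ι
  W : Set E
  D : Set E
  u : E → ℝ
  W_disjoint : ∀ y ∈ W, y ∉ K
  D_subset : D ⊆ W
  eventually_idx : ∀ y ∈ W, ∀ᶠ x in 𝓝 y, x ∈ W ∧ idx x = idx y
  eventually_notMem_D : ∀ y ∉ K, y ∉ D → ∀ᶠ x in 𝓝 y, x ∉ D
  continuousOn_u : ContinuousOn u Kᶜ
  u_mem : ∀ y, u y ∈ Set.Icc (0 : ℝ) 1
  u_eq_one : ∀ y ∈ D, u y = 1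
  eventually_u_eq_zero : ∀ y ∉ K, y ∉ W → ∀ᶠ x in 𝓝 y, u x = 0
  small : ∀ ε > 0, ∃ δ > 0, ∀ y ∈ W, ∀ x ∈ W, idx x = idx y → Metric.infDist y K < δ →
    dist x y < ε

/-- A continuous map to `K`, defined on the part near `K` of a subset `C` of the complement of `K`,
which tends to the identity at `K`. -/
structure IsPartialRetraction (K C : Set E) (g : E → K) : Prop where
  continuousOn : ∃ ρ > 0, ContinuousOn g (C ∩ {y | y ∉ K ∧ Metric.infDist y K < ρ})
  dist_lt : ∀ ε > 0, ∃ δ > 0, ∀ y ∈ C, y ∉ K → Metric.infDist y K < δ → dist (g y : E) y < ε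

/-- The image under `g` of a cell, together with a point of `K` near the cell, is contained in a set
`S i` which contracts by a small move, and the moves tend to `0` as the cells approach `K`. -/
theorem CellFamily.exists_contractions {K : Set E} (hK : IsCompact K) (hne : K.Nonempty)
    (hU : HasUniformContractions K) {ι : Type*} (F : CellFamily K ι) {C : Set E} {g : E → K}
    (hg : IsPartialRetraction K C g) :
    ∃ (H : ι → K → ℝ → K) (c : ι → K) (k : ι → K) (S : ι → Set K),
      (∀ i, k i ∈ S i) ∧ (∀ y ∈ C, y ∈ F.W → g y ∈ S (F.idx y)) ∧
      ∀ ε > 0, ∃ δ > 0, ∀ y ∈ F.W, Metric.infDist y K < δ →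
        IsSmallContraction (S (F.idx y)) ε (H (F.idx y)) (c (F.idx y)) ∧
        dist (k (F.idx y) : E) y < ε := by
  classical
  have hnear : ∀ y : E, ∃ z : K, Metric.infDist y K = dist y z := fun y ↦ by
    obtain ⟨z, hz, h⟩ := hK.exists_infDist_eq_dist hne y
    exact ⟨⟨z, hz⟩, h⟩
  choose near hnear using hnear
  obtain ⟨z₀, hz₀⟩ := hne
  -- a reference point in every cell
  let pt : ι → E := fun i ↦ if h : ∃ y ∈ F.W, F.idx y = i then h.choose else z₀
  have hpt : ∀ y ∈ F.W, pt (F.idx y) ∈ F.W ∧ F.idx (pt (F.idx y)) = F.idx y := by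
    intro y hy
    have h : ∃ x ∈ F.W, F.idx x = F.idx y := ⟨y, hy, rfl⟩
    simp only [pt, h, dif_pos]
    exact h.choose_spec
  let k : ι → K := fun i ↦ near (pt i)
  let S : ι → Set K := fun i ↦ insert (k i) (g '' (C ∩ {y | y ∈ F.W ∧ F.idx y = i}))
  let R : ι → Set ℝ := fun i ↦ {ε | 0 < ε ∧ ∃ H c, IsSmallContraction (S i) ε H c}
  -- Contractions of almost optimal size. Their size tends to `0` along cells approaching `K`,
  -- without any choice of scales beforehand.
  have hbest : ∀ i, ∃ H c, (R i).Nonempty → 0 < Metric.infDist (pt i) K →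
      ∃ ε < sInf (R i) + Metric.infDist (pt i) K, IsSmallContraction (S i) ε H c := by
    intro i
    by_cases h : (R i).Nonempty ∧ 0 < Metric.infDist (pt i) K
    · obtain ⟨ε, ⟨_, H, c, hH⟩, hlt⟩ := Real.lt_sInf_add_pos h.1 h.2
      exact ⟨H, c, fun _ _ ↦ ⟨ε, hlt, hH⟩⟩
    · exact ⟨fun _ _ ↦ ⟨z₀, hz₀⟩, ⟨z₀, hz₀⟩, fun h1 h2 ↦ absurd ⟨h1, h2⟩ h⟩
  choose H c hHc using hbest
  refine ⟨H, c, k, S, fun i ↦ Set.mem_insert _ _, fun y hyC hyW ↦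
    Set.mem_insert_of_mem _ ⟨y, ⟨hyC, hyW, rfl⟩, rfl⟩, fun ε hε ↦ ?_⟩
  obtain ⟨δ₁, hδ₁, hS⟩ := hU (ε / 2) (half_pos hε)
  set η := min (δ₁ / 16) (ε / 8) with hη
  have hηpos : 0 < η := by positivity
  have hη1 : η ≤ δ₁ / 16 := min_le_left _ _
  have hη2 : η ≤ ε / 8 := min_le_right _ _
  obtain ⟨δg, hδg, hgδ⟩ := hg.dist_lt η hηpos
  obtain ⟨δs, hδs, hsδ⟩ := F.small (min η (δg / 2)) (by positivity)
  refine ⟨min δs (min (δg / 2) η), by positivity, fun y hy hyd ↦ ?_⟩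
  rw [lt_min_iff, lt_min_iff] at hyd
  obtain ⟨hyd1, hyd2, hyd3⟩ := hyd
  have hcell : ∀ x ∈ F.W, F.idx x = F.idx y → dist x y < η ∧ Metric.infDist x K < δg ∧
      Metric.infDist x K < 2 * η := by
    intro x hx hxy
    have h1 := hsδ y hy x hx hxy hyd1
    rw [lt_min_iff] at h1
    have h2 : Metric.infDist x K ≤ Metric.infDist y K + dist x y :=
      Metric.infDist_le_infDist_add_dist
    exact ⟨h1.1, by linarith, by linarith⟩
  set i := F.idx y with hi
  obtain ⟨hpW, hpi⟩ := hpt y hy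
  obtain ⟨hp1, hp2, hp3⟩ := hcell _ hpW hpi
  have hky : dist (k i : E) y < 3 * η := by
    have h1 : dist (pt i) (k i) = Metric.infDist (pt i) K := (hnear _).symm
    have h2 := dist_triangle_left (k i : E) y (pt i)
    rw [h1] at h2
    linarith
  have hSy : ∀ w ∈ S i, dist (w : E) y < 3 * η := by
    rintro w (rfl | ⟨x, ⟨hxC, hxW, hxi⟩, rfl⟩)
    · exact hky
    · obtain ⟨hx1, hx2, hx3⟩ := hcell x hxW hxi
      have := hgδ x hxC (F.W_disjoint x hxW) hx2
      have := dist_triangle (g x : E) x y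
      linarith
  obtain ⟨H', c', hHc'⟩ := hS (S i) ⟨k i, Set.mem_insert _ _⟩ fun w hw w' hw' ↦ by
    have := hSy w hw
    have := hSy w' hw'
    have := dist_triangle_right (w : E) w' y
    rw [Subtype.dist_eq]
    linarith
  have hR : ε / 2 ∈ R i := ⟨half_pos hε, H', c', hHc'⟩
  have hKc : IsClosed K := hK.isClosed
  obtain ⟨ε', hε', hfin⟩ := hHc i ⟨_, hR⟩
    ((hKc.notMem_iff_infDist_pos ⟨z₀, hz₀⟩).1 (F.W_disjoint _ hpW))
  have hinf : sInf (R i) ≤ ε / 2 := csInf_le ⟨0, fun e he ↦ he.1.le⟩ hR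
  exact ⟨hfin.mono (by linarith), by linarith⟩

/-- A partial retraction over `C` can be modified so that it extends over the closed parts of the
cells of one colour: inside a cell, `g y` is moved along a small contraction for the time `u y`, so
that `g` becomes constant where `u = 1` and may there be continued by this constant. -/
theorem IsPartialRetraction.extend {K : Set E} (hK : IsCompact K) (hne : K.Nonempty)
    (hU : HasUniformContractions K) {ι : Type*} (F : CellFamily K ι) {C : Set E} {g : E → K}
    (hC : ∀ y ∉ K, y ∉ C → ∀ᶠ x in 𝓝 y, x ∉ C) (hg : IsPartialRetraction K C g) :
    ∃ g' : E → K, IsPartialRetraction K (C ∪ F.D) g' := by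
  classical
  obtain ⟨H, c, k, S, hkS, hgS, hsm⟩ := F.exists_contractions hK hne hU hg
  let g' : E → K := fun y ↦ if y ∈ F.D then c (F.idx y) else
    if y ∈ F.W then H (F.idx y) (g y) (F.u y) else g y
  have hgD : ∀ y ∈ F.D, g' y = c (F.idx y) := fun y hy ↦ by simp [g', hy]
  have hgW : ∀ y ∈ C, y ∈ F.W → ∀ ε, IsSmallContraction (S (F.idx y)) ε (H (F.idx y))
      (c (F.idx y)) → g' y = H (F.idx y) (g y) (F.u y) := by
    intro y hyC hyW ε hε
    by_cases hyD : y ∈ F.D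
    · rw [hgD y hyD, F.u_eq_one y hyD, hε.map_one _ (hgS y hyC hyW)]
    · simp [g', hyD, hyW]
  have hgn : ∀ y ∉ F.W, g' y = g y := fun y hy ↦ by
    have : y ∉ F.D := fun h ↦ hy (F.D_subset h)
    simp [g', this, hy]
  refine ⟨g', ?_, fun ε hε ↦ ?_⟩
  · obtain ⟨ρ, hρ, hgc⟩ := hg.continuousOn
    obtain ⟨ρ₁, hρ₁, hsm1⟩ := hsm 1 one_pos
    refine ⟨min ρ ρ₁, by positivity, ?_⟩
    have hRo : ∀ y, y ∉ K → Metric.infDist y K < min ρ ρ₁ →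
        ∀ᶠ x in 𝓝 y, x ∉ K ∧ Metric.infDist x K < ρ ∧ Metric.infDist x K < ρ₁ := by
      intro y hyK hy
      filter_upwards [hK.isClosed.isOpen_compl.mem_nhds hyK,
        (Metric.continuous_infDist_pt K).continuousAt.eventually_lt continuousAt_const hy]
        with x hx hx'
      exact ⟨hx, lt_min_iff.1 hx'⟩
    rintro y ⟨hyCD, hyK, hyρ⟩
    have hyev := hRo y hyK hyρ
    have hyρ1 : Metric.infDist y K < ρ₁ := (lt_min_iff.1 hyρ).2
    refine ContinuousWithinAt.mono ?_ (Set.inter_subset_left (s := C ∪ F.D))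
    have hgy : y ∈ C → ContinuousWithinAt g C y := by
      intro hyC
      refine (hgc y ⟨hyC, hyK, (lt_min_iff.1 hyρ).1⟩).mono_of_mem_nhdsWithin ?_
      filter_upwards [self_mem_nhdsWithin, nhdsWithin_le_nhds hyev] with x hx hx'
      exact ⟨hx, hx'.1, hx'.2.1⟩
    by_cases hyW : y ∈ F.W
    · have hidx := F.eventually_idx y hyW
      refine ContinuousWithinAt.union ?_ ?_
      · by_cases hyC : y ∈ C
        · have hcont := (hsm1 y hyW hyρ1).1.continuousOn
          have h1 : ContinuousWithinAt (fun x ↦ (g x, F.u x)) (C ∩ {x | x ∈ F.W ∧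
              F.idx x = F.idx y}) y :=
            ((hgy hyC).mono Set.inter_subset_left).prodMk
              (F.continuousOn_u.continuousAt
                (hK.isClosed.isOpen_compl.mem_nhds hyK)).continuousWithinAt
          have h2 := (hcont _ ⟨hgS y hyC hyW, trivial⟩).comp h1 (by
            rintro x ⟨hxC, hxW, hxi⟩
            exact ⟨hxi ▸ hgS x hxC hxW, trivial⟩)
          have h3 := h2.mono_of_mem_nhdsWithin (s := C) (by
            filter_upwards [self_mem_nhdsWithin, nhdsWithin_le_nhds hidx] with x hx hx'
            exact ⟨hx, hx'⟩)
          refine h3.congr_of_eventuallyEq ?_ (hgW y hyC hyW _ (hsm1 y hyW hyρ1).1)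
          filter_upwards [self_mem_nhdsWithin, nhdsWithin_le_nhds hidx, nhdsWithin_le_nhds hyev]
            with x hx hx' hx''
          rw [hgW x hx hx'.1 _ (hsm1 x hx'.1 hx''.2.2).1, hx'.2]
          rfl
        · have : 𝓝[C] y = ⊥ := by
            rw [← Filter.empty_mem_iff_bot]
            filter_upwards [self_mem_nhdsWithin, nhdsWithin_le_nhds (hC y hyK hyC)] with x hx hx'
            exact hx' hx
          rw [ContinuousWithinAt, this]
          exact Filter.tendsto_bot
      · by_cases hyD : y ∈ F.D
        · refine (continuousWithinAt_const (b := c (F.idx y))).congr_of_eventuallyEq ?_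
            (hgD y hyD)
          filter_upwards [self_mem_nhdsWithin, nhdsWithin_le_nhds hidx] with x hx hx'
          rw [hgD x hx, hx'.2]
        · have : 𝓝[F.D] y = ⊥ := by
            rw [← Filter.empty_mem_iff_bot]
            filter_upwards [self_mem_nhdsWithin,
              nhdsWithin_le_nhds (F.eventually_notMem_D y hyK hyD)] with x hx hx'
            exact hx' hx
          rw [ContinuousWithinAt, this]
          exact Filter.tendsto_bot
    · have hyD : y ∉ F.D := fun h ↦ hyW (F.D_subset h)
      have hyC : y ∈ C := hyCD.resolve_right hyD
      have hDn := F.eventually_notMem_D y hyK hyD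
      have h1 : ContinuousWithinAt g (C ∪ F.D) y := by
        refine (hgy hyC).mono_of_mem_nhdsWithin ?_
        filter_upwards [self_mem_nhdsWithin, nhdsWithin_le_nhds hDn] with x hx hx'
        exact hx.resolve_right hx'
      refine h1.congr_of_eventuallyEq ?_ (hgn y hyW)
      filter_upwards [self_mem_nhdsWithin, nhdsWithin_le_nhds hDn,
        nhdsWithin_le_nhds (F.eventually_u_eq_zero y hyK hyW), nhdsWithin_le_nhds hyev]
        with x hx hx' hxu hxe
      have hxC := hx.resolve_right hx'
      by_cases hxW : x ∈ F.W
      · have hs := (hsm1 x hxW hxe.2.2).1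
        rw [hgW x hxC hxW _ hs, hxu, hs.map_zero _ (hgS x hxC hxW)]
      · exact hgn x hxW
  · obtain ⟨δ₁, hδ₁, h1⟩ := hsm (ε / 2) (half_pos hε)
    obtain ⟨δ₂, hδ₂, h2⟩ := hg.dist_lt (ε / 2) (half_pos hε)
    refine ⟨min δ₁ δ₂, by positivity, fun y hy hyK hyd ↦ ?_⟩
    rw [lt_min_iff] at hyd
    by_cases hyD : y ∈ F.D
    · obtain ⟨hs, hk⟩ := h1 y (F.D_subset hyD) hyd.1
      have h3 := hs.dist_lt _ (hkS _) 1 (by simp)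
      rw [hs.map_one _ (hkS _), Subtype.dist_eq] at h3
      rw [hgD y hyD]
      have := dist_triangle (c (F.idx y) : E) (k (F.idx y)) y
      linarith
    · have hyC := hy.resolve_right hyD
      have h4 := h2 y hyC hyK hyd.2
      by_cases hyW : y ∈ F.W
      · obtain ⟨hs, hk⟩ := h1 y hyW hyd.1
        rw [hgW y hyC hyW _ hs]
        have h3 := hs.dist_lt _ (hgS y hyC hyW) _ (F.u_mem y)
        rw [Subtype.dist_eq] at h3
        have := dist_triangle (H (F.idx y) (g y) (F.u y) : E) (g y) y
        linarith
      · rw [hgn y hyW]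
        linarith

/-- If finitely many colours cover the complement of `K`, extending over one colour after another
gives a retraction of a neighbourhood of `K`. -/
theorem isNeighborhoodRetract_of_cellFamilies {K : Set E} (hK : IsCompact K)
    (hU : HasUniformContractions K) {Γ : Type*} [Finite Γ] {ι : Type*} (F : Γ → CellFamily K ι)
    (hF : ∀ y ∉ K, ∃ χ, y ∈ (F χ).D) : IsNeighborhoodRetract K := by
  classical
  rcases K.eq_empty_or_nonempty with rfl | hne
  · exact ⟨∅, isOpen_empty, subset_rfl, id, by simp, by simp [Set.MapsTo], fun _ _ ↦ rfl⟩
  have hmain : ∀ T : Set Γ, T.Finite →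
      ∃ g : E → K, IsPartialRetraction K (⋃ χ ∈ T, (F χ).D) g := by
    intro T hT
    induction T, hT using Set.Finite.induction_on with
    | empty =>
      obtain ⟨z, hz⟩ := hne
      exact ⟨fun _ ↦ ⟨z, hz⟩, ⟨1, one_pos, by simp⟩, fun ε hε ↦ ⟨1, one_pos, by simp⟩⟩
    | @insert χ T _ hT ih =>
      obtain ⟨g, hg⟩ := ih
      rw [Set.biUnion_insert, Set.union_comm]
      refine hg.extend hK hne hU (F χ) fun y hyK hy ↦ ?_
      have : ∀ᶠ x in 𝓝 y, ∀ χ ∈ T, x ∉ (F χ).D :=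
        (Filter.eventually_all_finite hT).2 fun χ hχ ↦
          (F χ).eventually_notMem_D y hyK fun h ↦ hy (Set.mem_biUnion hχ h)
      filter_upwards [this] with x hx hx'
      obtain ⟨χ, hχ, h⟩ := Set.mem_iUnion₂.1 hx'
      exact hx χ hχ h
  obtain ⟨g, ⟨ρ, hρ, hgc⟩, hgd⟩ := hmain Set.univ Set.finite_univ
  have hall : ∀ y ∉ K, y ∈ ⋃ χ ∈ (Set.univ : Set Γ), (F χ).D := fun y hy ↦ by
    obtain ⟨χ, hχ⟩ := hF y hy
    exact Set.mem_biUnion (Set.mem_univ χ) hχ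
  let r : E → E := fun y ↦ if y ∈ K then y else g y
  have hrK : ∀ y ∈ K, r y = y := fun y hy ↦ by simp [r, hy]
  have hrn : ∀ y ∉ K, r y = g y := fun y hy ↦ by simp [r, hy]
  refine ⟨{y | Metric.infDist y K < ρ},
    isOpen_lt (Metric.continuous_infDist_pt K) continuous_const, fun y hy ↦ ?_, r, ?_, ?_, hrK⟩
  · simpa [Metric.infDist_zero_of_mem hy] using hρ
  · intro y hy
    refine ContinuousAt.continuousWithinAt ?_
    by_cases hyK : y ∈ K
    · rw [ContinuousAt, hrK y hyK, Metric.tendsto_nhds]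
      intro ε hε
      obtain ⟨δ, hδ, h⟩ := hgd (ε / 2) (half_pos hε)
      filter_upwards [Metric.ball_mem_nhds y (lt_min hδ (half_pos hε))] with x hx
      rw [Metric.mem_ball, lt_min_iff] at hx
      by_cases hxK : x ∈ K
      · rw [hrK x hxK]
        linarith
      · rw [hrn x hxK]
        have := h x (hall x hxK) hxK ((Metric.infDist_le_dist_of_mem hyK).trans_lt hx.1)
        have := dist_triangle (g x : E) x y
        linarith
    · have hn : {y | y ∉ K ∧ Metric.infDist y K < ρ} ∈ 𝓝 y :=
        Filter.inter_mem (hK.isClosed.isOpen_compl.mem_nhds hyK)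
          ((isOpen_lt (Metric.continuous_infDist_pt K) continuous_const).mem_nhds hy)
      have h1 : ContinuousAt g y := hgc.continuousAt (by
        filter_upwards [hn] with x hx
        exact ⟨hall x hx.1, hx⟩)
      refine (continuous_subtype_val.continuousAt.comp h1).congr ?_
      filter_upwards [hn] with x hx
      exact (hrn x hx.1).symm
  · intro y _
    by_cases hyK : y ∈ K
    · rwa [hrK y hyK]
    · rw [hrn y hyK]
      exact (g y).2

end CellFamily

/-! ### Compact locally contractible subsets of Euclidean spaces -/

/-- The distance from a real number to the nearest integer. -/
noncomputable def distInt (p : ℝ) : ℝ := |p - round p|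

theorem continuous_distInt : Continuous distInt := by
  have : distInt = fun p : ℝ ↦ ‖(p : UnitAddCircle)‖ := by
    funext p
    rw [UnitAddCircle.norm_eq, distInt]
  rw [this]
  exact continuous_norm.comp (AddCircle.continuous_mk' 1)

theorem round_eq_of_abs_sub_lt {p : ℝ} {n : ℤ} (h : |p - n| < 1 / 2) : round p = n := by
  rw [round_eq, Int.floor_eq_iff]
  rw [abs_lt] at h
  constructor <;> linarith

theorem eventually_round_eq {p : ℝ} (h : distInt p < 1 / 2) : ∀ᶠ q in 𝓝 p, round q = round p := by
  have : ContinuousAt (fun q : ℝ ↦ |q - round p|) p := by fun_prop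
  filter_upwards [this.eventually_lt continuousAt_const h] with q hq
  exact round_eq_of_abs_sub_lt hq

/-- Every real number is well inside one of the two families of slabs. -/
theorem exists_distInt_le (q : ℝ) : ∃ χ : Fin 2, distInt ((q - (χ : ℕ)) / 2) ≤ 1 / 4 := by
  have hq := abs_sub_round q
  rw [abs_le] at hq
  have key : ∀ (p : ℝ) (n : ℤ), |p - n| ≤ 1 / 4 → distInt p ≤ 1 / 4 := fun p n h ↦
    (round_le p n).trans h
  rcases Int.even_or_odd' (round q) with ⟨m, hm | hm⟩
  · refine ⟨0, key _ m ?_⟩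
    rw [hm] at hq
    push_cast at hq ⊢
    rw [abs_le]
    constructor <;> simp <;> linarith
  · refine ⟨1, key _ m ?_⟩
    rw [hm] at hq
    push_cast at hq ⊢
    rw [abs_le]
    constructor <;> simp <;> linarith

/-- A continuous function equal to `1` within `1 / 4` of the integers and to `0` outside distance
`5 / 16` from them. -/
noncomputable def bump (p : ℝ) : ℝ := max 0 (min 1 ((5 / 16 - distInt p) * 16))

theorem continuous_bump : Continuous bump := by
  have := continuous_distInt
  unfold bump
  fun_prop

theorem bump_mem (p : ℝ) : bump p ∈ Set.Icc (0 : ℝ) 1 :=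
  ⟨le_max_left _ _, max_le zero_le_one (min_le_left _ _)⟩

theorem bump_eq_one {p : ℝ} (h : distInt p ≤ 1 / 4) : bump p = 1 := by
  unfold bump
  rw [min_eq_left (by linarith), max_eq_right zero_le_one]

theorem bump_eq_zero {p : ℝ} (h : 5 / 16 ≤ distInt p) : bump p = 0 := by
  unfold bump
  exact max_eq_left ((min_le_right _ _).trans (by linarith))

theorem eventually_bump_eq_zero {X : Type*} [TopologicalSpace X] {f : X → ℝ} {y : X}
    (hf : ContinuousAt f y) (h : 3 / 8 ≤ distInt (f y)) : ∀ᶠ x in 𝓝 y, bump (f x) = 0 := by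
  have := continuous_distInt.continuousAt.comp hf
  filter_upwards [this.eventually_const_lt (show (5 : ℝ) / 16 < distInt (f y) by linarith)]
    with x hx using bump_eq_zero hx.le

section Grid
variable {N : ℕ} (K : Set (Fin N → ℝ)) (χ : Fin 2 × (Fin N → Fin 2))

/-- The logarithmic distance to `K`, shifted and scaled so that the shells of parity `χ.1` are the
neighbourhoods of the integers. -/
noncomputable def shellCoord (y : Fin N → ℝ) : ℝ :=
  (-Real.logb 2 (Metric.infDist y K) - (χ.1 : ℕ)) / 2

/-- The mesh of the grid in the shell of `y`; it is comparable to the distance from `y` to `K`. -/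
noncomputable def mesh (y : Fin N → ℝ) : ℝ := (1 / 4) ^ round (shellCoord K χ y)

/-- The `l`-th coordinate in the grid of the shell of `y`; the slabs of parity `χ.2 l` are the
neighbourhoods of the integers. -/
noncomputable def cellCoord (y : Fin N → ℝ) (l : Fin N) : ℝ :=
  (y l / mesh K χ y - (χ.2 l : ℕ)) / 2

/-- The points off `K` all of whose coordinates, those of the shell and of the grid, have a distance
to the nearest integer that satisfies `c`. -/
def cellSet (c : ℝ → Prop) : Set (Fin N → ℝ) :=
  {y | y ∉ K ∧ c (distInt (shellCoord K χ y)) ∧ ∀ l, c (distInt (cellCoord K χ y l))}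

variable {K χ}

theorem continuousAt_shellCoord (hK : IsCompact K) (hne : K.Nonempty) {y : Fin N → ℝ}
    (hy : y ∉ K) : ContinuousAt (shellCoord K χ) y := by
  have h1 : Metric.infDist y K ≠ 0 := ((hK.isClosed.notMem_iff_infDist_pos hne).1 hy).ne'
  have h2 : ContinuousAt (fun y ↦ Metric.infDist y K) y :=
    (Metric.continuous_infDist_pt K).continuousAt
  have h3 : ContinuousAt (fun y ↦ Real.logb 2 (Metric.infDist y K)) y :=
    (h2.log h1).div_const _
  unfold shellCoord
  fun_prop

theorem eventually_mesh_eq (hK : IsCompact K) (hne : K.Nonempty) {y : Fin N → ℝ}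
    (hy : y ∉ K) (h : distInt (shellCoord K χ y) < 1 / 2) :
    ∀ᶠ x in 𝓝 y, round (shellCoord K χ x) = round (shellCoord K χ y) :=
  (continuousAt_shellCoord hK hne hy).eventually (eventually_round_eq h)

theorem continuousAt_cellCoord (hK : IsCompact K) (hne : K.Nonempty) {y : Fin N → ℝ}
    (hy : y ∉ K) (h : distInt (shellCoord K χ y) < 1 / 2) (l : Fin N) :
    ContinuousAt (fun x ↦ cellCoord K χ x l) y := by
  have : ContinuousAt (fun x : Fin N → ℝ ↦ (x l / mesh K χ y - (χ.2 l : ℕ)) / 2) y :=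
    (((continuous_apply l).continuousAt.div_const _).sub continuousAt_const).div_const _
  refine this.congr ?_
  filter_upwards [eventually_mesh_eq hK hne hy h] with x hx
  simp only [cellCoord, mesh, hx]

theorem mesh_le (hK : IsCompact K) (hne : K.Nonempty) {y : Fin N → ℝ} (hy : y ∉ K)
    (h : distInt (shellCoord K χ y) < 3 / 8) : mesh K χ y ≤ 4 * Metric.infDist y K := by
  have hpos : 0 < Metric.infDist y K := (hK.isClosed.notMem_iff_infDist_pos hne).1 hy
  have h1 := (abs_lt.1 h).2
  have hχ : ((χ.1 : ℕ) : ℝ) ≤ 1 := by exact_mod_cast Nat.lt_succ_iff.1 χ.1.2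
  have h2 : (2 : ℝ) * (-round (shellCoord K χ y) - 1 : ℤ) < Real.logb 2 (Metric.infDist y K) := by
    have : Real.logb 2 (Metric.infDist y K) = -(2 * shellCoord K χ y + (χ.1 : ℕ)) := by
      unfold shellCoord
      ring
    rw [this]
    push_cast
    linarith
  rw [Real.lt_logb_iff_rpow_lt (by norm_num) hpos, Real.rpow_mul (by norm_num),
    Real.rpow_intCast] at h2
  have h3 : ((2 : ℝ) ^ (2 : ℝ)) = 4 := by norm_num
  rw [h3, zpow_sub₀ (by norm_num), zpow_neg, zpow_one] at h2
  unfold mesh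
  rw [one_div, inv_zpow]
  linarith

theorem exists_mem_cellSet (K : Set (Fin N → ℝ)) {y : Fin N → ℝ} (hy : y ∉ K) :
    ∃ χ, y ∈ cellSet K χ (· ≤ 1 / 4) := by
  obtain ⟨χ₀, h0⟩ := exists_distInt_le (-Real.logb 2 (Metric.infDist y K))
  have h1 : ∀ l, _ := fun l ↦ exists_distInt_le
    (y l / (1 / 4) ^ round ((-Real.logb 2 (Metric.infDist y K) - (χ₀ : ℕ)) / 2))
  choose χ h1 using h1
  exact ⟨(χ₀, χ), hy, h0, h1⟩

theorem eventually_mem_cellSet (hK : IsCompact K) (hne : K.Nonempty) {y : Fin N → ℝ}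
    (hy : y ∈ cellSet K χ (· < 3 / 8)) : ∀ᶠ x in 𝓝 y, x ∈ cellSet K χ (· < 3 / 8) ∧
      (round (shellCoord K χ x), fun l ↦ round (cellCoord K χ x l)) =
      (round (shellCoord K χ y), fun l ↦ round (cellCoord K χ y l)) := by
  obtain ⟨hyK, hy0, hyl⟩ := hy
  have hy0' : distInt (shellCoord K χ y) < 1 / 2 := lt_trans hy0 (by norm_num)
  have c0 := continuousAt_shellCoord (χ := χ) hK hne hyK
  have cl := continuousAt_cellCoord hK hne hyK hy0'
  have e1 : ∀ᶠ x in 𝓝 y, ∀ l, distInt (cellCoord K χ x l) < 3 / 8 ∧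
      round (cellCoord K χ x l) = round (cellCoord K χ y l) :=
    Filter.eventually_all.2 fun l ↦
      ((continuous_distInt.continuousAt.comp (cl l)).eventually_lt continuousAt_const (hyl l)).and
        ((cl l).eventually (eventually_round_eq (lt_trans (hyl l) (by norm_num))))
  filter_upwards [hK.isClosed.isOpen_compl.mem_nhds hyK, eventually_mesh_eq hK hne hyK hy0',
    (continuous_distInt.continuousAt.comp c0).eventually_lt continuousAt_const hy0, e1]
    with x hxK hx hx0 hxl
  exact ⟨⟨hxK, hx0, fun l ↦ (hxl l).1⟩, by rw [hx]; simp only [(hxl _).2]⟩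

theorem eventually_notMem_cellSet (hK : IsCompact K) (hne : K.Nonempty) {y : Fin N → ℝ}
    (hyK : y ∉ K) (hy : y ∉ cellSet K χ (· ≤ 1 / 4)) :
    ∀ᶠ x in 𝓝 y, x ∉ cellSet K χ (· ≤ 1 / 4) := by
  by_cases h0 : distInt (shellCoord K χ y) ≤ 1 / 4
  · have : ∃ l, 1 / 4 < distInt (cellCoord K χ y l) := by
      by_contra! h
      exact hy ⟨hyK, h0, h⟩
    obtain ⟨l, hl⟩ := this
    have cl := continuousAt_cellCoord hK hne hyK (h0.trans_lt (by norm_num)) l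
    filter_upwards [(continuous_distInt.continuousAt.comp cl).eventually_const_lt hl] with x hx h
    exact absurd (h.2.2 l) (not_le.2 hx)
  · have c0 := continuousAt_shellCoord (χ := χ) hK hne hyK
    filter_upwards [(continuous_distInt.continuousAt.comp c0).eventually_const_lt (not_le.1 h0)]
      with x hx h
    exact absurd h.2.1 (not_le.2 hx)

/-- The product of the bumps in all coordinates. -/
noncomputable def cellBump (K : Set (Fin N → ℝ)) (χ : Fin 2 × (Fin N → Fin 2))
    (y : Fin N → ℝ) : ℝ :=
  bump (shellCoord K χ y) * ∏ l, bump (cellCoord K χ y l)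

theorem eventually_cellBump_eq_zero (hK : IsCompact K) (hne : K.Nonempty) {y : Fin N → ℝ}
    (hyK : y ∉ K) (hy : y ∉ cellSet K χ (· < 3 / 8)) : ∀ᶠ x in 𝓝 y, cellBump K χ x = 0 := by
  by_cases h0 : distInt (shellCoord K χ y) < 3 / 8
  · have : ∃ l, 3 / 8 ≤ distInt (cellCoord K χ y l) := by
      by_contra! h
      exact hy ⟨hyK, h0, h⟩
    obtain ⟨l, hl⟩ := this
    have cl := continuousAt_cellCoord hK hne hyK (h0.trans (by norm_num)) l
    filter_upwards [eventually_bump_eq_zero cl hl] with x hx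
    rw [cellBump, Finset.prod_eq_zero (Finset.mem_univ l) hx, mul_zero]
  · filter_upwards [eventually_bump_eq_zero (continuousAt_shellCoord hK hne hyK) (not_lt.1 h0)]
      with x hx
    rw [cellBump, hx, zero_mul]

theorem continuousOn_cellBump (hK : IsCompact K) (hne : K.Nonempty) :
    ContinuousOn (cellBump K χ) Kᶜ := by
  intro y hyK
  refine ContinuousAt.continuousWithinAt ?_
  have c0 := continuousAt_shellCoord (χ := χ) hK hne hyK
  by_cases h0 : distInt (shellCoord K χ y) < 1 / 2
  · exact (continuous_bump.continuousAt.comp c0).mul (tendsto_finsetProd _ fun l _ ↦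
      continuous_bump.continuousAt.comp (continuousAt_cellCoord hK hne hyK h0 l))
  · refine (continuousAt_const (y := (0 : ℝ))).congr ?_
    filter_upwards [eventually_cellBump_eq_zero hK hne hyK
      fun h ↦ h0 (lt_trans h.2.1 (by norm_num))] with x hx using hx.symm

theorem cellSet_small (hK : IsCompact K) (hne : K.Nonempty) {x y : Fin N → ℝ}
    (hx : x ∈ cellSet K χ (· < 3 / 8)) (hy : y ∈ cellSet K χ (· < 3 / 8))
    (hxy : (round (shellCoord K χ x), fun l ↦ round (cellCoord K χ x l)) =
      (round (shellCoord K χ y), fun l ↦ round (cellCoord K χ y l))) :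
    dist x y ≤ 6 * Metric.infDist y K := by
  rw [Prod.mk.injEq] at hxy
  have hm : mesh K χ x = mesh K χ y := by rw [mesh, mesh, hxy.1]
  have hpos : 0 < mesh K χ y := by unfold mesh; positivity
  have hle := mesh_le hK hne hy.1 hy.2.1
  refine (dist_pi_le_iff (mul_nonneg (by norm_num) Metric.infDist_nonneg)).2 fun l ↦ ?_
  have h1 := abs_lt.1 (hx.2.2 l)
  have h2 := abs_lt.1 (hy.2.2 l)
  rw [congrFun hxy.2 l] at h1
  have h3 : x l - y l = 2 * mesh K χ y * (cellCoord K χ x l - cellCoord K χ y l) := by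
    unfold cellCoord
    rw [hm]
    field_simp
    ring
  rw [Real.dist_eq, h3, abs_mul, abs_of_pos (by positivity)]
  have h4 : |cellCoord K χ x l - cellCoord K χ y l| ≤ 3 / 4 := by
    rw [abs_le]
    constructor <;> linarith
  nlinarith

/-- The colour `χ` of the Whitney decomposition of the complement of `K` into shells and, within each
shell, the cells of a cubical grid. -/
noncomputable def gridCells (hK : IsCompact K) (hne : K.Nonempty)
    (χ : Fin 2 × (Fin N → Fin 2)) : CellFamily K (ℤ × (Fin N → ℤ)) where
  idx y := (round (shellCoord K χ y), fun l ↦ round (cellCoord K χ y l))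
  W := cellSet K χ (· < 3 / 8)
  D := cellSet K χ (· ≤ 1 / 4)
  u := cellBump K χ
  W_disjoint _ hy := hy.1
  D_subset y hy := ⟨hy.1, lt_of_le_of_lt hy.2.1 (by norm_num),
    fun l ↦ lt_of_le_of_lt (hy.2.2 l) (by norm_num)⟩
  eventually_idx _ hy := eventually_mem_cellSet hK hne hy
  eventually_notMem_D _ hyK hy := eventually_notMem_cellSet hK hne hyK hy
  continuousOn_u := continuousOn_cellBump hK hne
  u_mem y := ⟨mul_nonneg (bump_mem _).1 (Finset.prod_nonneg fun l _ ↦ (bump_mem _).1),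
    mul_le_one₀ (bump_mem _).2 (Finset.prod_nonneg fun l _ ↦ (bump_mem _).1)
      (Finset.prod_le_one (fun l _ ↦ (bump_mem _).1) fun l _ ↦ (bump_mem _).2)⟩
  u_eq_one y hy := by
    rw [cellBump, bump_eq_one hy.2.1, Finset.prod_eq_one fun l _ ↦ bump_eq_one (hy.2.2 l), one_mul]
  eventually_u_eq_zero _ hyK hy := eventually_cellBump_eq_zero hK hne hyK hy
  small ε hε := ⟨ε / 6, by positivity, fun y hy x hx hxy hd ↦
    (cellSet_small hK hne hx hy hxy).trans_lt (by linarith)⟩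

/-- Borsuk: a compact, locally contractible subset of a Euclidean space is a neighbourhood
retract. -/
theorem isNeighborhoodRetract_of_hasLocalContractions (hK : IsCompact K)
    (hL : HasLocalContractions K) : IsNeighborhoodRetract K := by
  rcases K.eq_empty_or_nonempty with rfl | hne
  · exact ⟨∅, isOpen_empty, subset_rfl, id, by simp, by simp [Set.MapsTo], fun _ _ ↦ rfl⟩
  have : CompactSpace K := isCompact_iff_compactSpace.1 hK
  exact isNeighborhoodRetract_of_cellFamilies hK hL.hasUniformContractions (gridCells hK hne)
    fun y hy ↦ exists_mem_cellSet K hy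

end Grid

theorem isANE_of_hasLocalContractions.{u, v} {Z : Type v} [TopologicalSpace Z] [CompactSpace Z]
    (hL : HasLocalContractions Z) {N : ℕ} {e : Z → Fin N → ℝ} (he : Continuous e)
    (hinj : Function.Injective e) : IsANE.{u} Z := by
  have hi : IsClosedEmbedding e := he.isClosedEmbedding hinj
  exact isANE_of_isEmbedding_of_isNeighborhoodRetract hi.isEmbedding
    (isNeighborhoodRetract_of_hasLocalContractions (isCompact_range he)
      (hL.of_homeomorph hi.isEmbedding.toHomeomorph))

/-! ### The space `Pf X` -/

theorem ext_of_forall_integral_eq {X : Type*} [MeasurableSpace X] {μ ν : ProbabilityMeasure X}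
    (h : ∀ φ : X → ℝ, ∫ x, φ x ∂(μ : Measure X) = ∫ x, φ x ∂(ν : Measure X)) : μ = ν := by
  refine ProbabilityMeasure.eq_of_forall_apply_eq μ ν fun S hS ↦ ?_
  have := h (S.indicator 1)
  rw [integral_indicator_one hS, integral_indicator_one hS] at this
  exact NNReal.coe_injective (by simpa using this)

section Carrier

variable {X : Type*} [MeasurableSpace X] [MeasurableSingletonClass X]

/-- The measure `μ` lives on the finite set `s`, and its mass at `c ∈ s` is at least what `Pf`
requires for a support of the size of `s`. Points of `s` may have mass `0`, which is harmless as the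
required mass grows with `s`; by `mem_Pf_iff`, carriers describe `Pf X`. -/
structure IsCarrier (μ : ProbabilityMeasure X) (s : Finset X) (c : X) : Prop where
  null : (μ : Measure X).real (s : Set X)ᶜ = 0
  mem : c ∈ s
  le : 1 - 1 / ((s.card : ℝ) + 1) ≤ (μ : Measure X).real {c}

theorem integral_eq_sum_of_null {μ : ProbabilityMeasure X} {s : Finset X}
    (h : (μ : Measure X).real (s : Set X)ᶜ = 0) (f : X → ℝ) :
    ∫ x, f x ∂(μ : Measure X) = ∑ x ∈ s, (μ : Measure X).real {x} * f x := by
  have h0 : (μ : Measure X) (s : Set X)ᶜ = 0 := (measureReal_eq_zero_iff).1 h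
  have hr : (μ : Measure X).restrict s = μ := Measure.restrict_eq_self_of_ae_mem (by
    rw [ae_iff]
    exact h0)
  have hi : IntegrableOn f s (μ : Measure X) := by
    exact IntegrableOn.of_finite s.finite_toSet
  conv_lhs => rw [← hr]
  rw [setIntegral_finset s hi]
  simp

theorem sum_real_singleton_of_null {μ : ProbabilityMeasure X} {s : Finset X}
    (h : (μ : Measure X).real (s : Set X)ᶜ = 0) : ∑ x ∈ s, (μ : Measure X).real {x} = 1 := by
  have := integral_eq_sum_of_null h fun _ ↦ 1
  simpa using this.symm

theorem real_eq_zero_of_integral {μ : ProbabilityMeasure X} {s : Finset X}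
    (h : ∫ x, (sᶜ : Set X).indicator 1 x ∂(μ : Measure X) = (0 : ℝ)) :
    (μ : Measure X).real (s : Set X)ᶜ = 0 := by
  rwa [integral_indicator_one s.measurableSet.compl] at h

/-- If `s` is a singleton, the requirement itself only says `1 / 2 ≤ μ {c}`; but then `μ {c} = 1`. -/
theorem IsCarrier.half_lt {μ : ProbabilityMeasure X} {s : Finset X} {c : X}
    (h : IsCarrier μ s c) : 1 / 2 < (μ : Measure X).real {c} := by
  have hpos : 0 < s.card := Finset.card_pos.2 ⟨c, h.mem⟩
  rcases Nat.lt_or_ge s.card 2 with h2 | h2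
  · have h1 : s.card = 1 := by omega
    obtain ⟨a, rfl⟩ := Finset.card_eq_one.1 h1
    have := sum_real_singleton_of_null h.null
    have hc : c = a := by simpa using h.mem
    rw [hc]
    simp only [Finset.sum_singleton] at this
    rw [this]
    norm_num
  · have h3 : (2 : ℝ) ≤ s.card := by exact_mod_cast h2
    have h4 : 1 / ((s.card : ℝ) + 1) ≤ 1 / 3 := by
      apply one_div_le_one_div_of_le <;> linarith
    have := h.le
    linarith

theorem eq_of_half_lt {μ : ProbabilityMeasure X} {x y : X}
    (hx : 1 / 2 < (μ : Measure X).real {x}) (hy : 1 / 2 < (μ : Measure X).real {y}) : x = y := by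
  by_contra hne
  have h1 : (μ : Measure X).real ({x} ∪ {y}) =
      (μ : Measure X).real {x} + (μ : Measure X).real {y} :=
    measureReal_union (by simpa using hne) (measurableSet_singleton y)
  have h2 : (μ : Measure X).real ({x} ∪ {y}) ≤ 1 := measureReal_le_one
  linarith

theorem one_sub_le_of_card_le {m n : ℕ} (h : m ≤ n) :
    (1 : ℝ) - 1 / ((m : ℝ) + 1) ≤ 1 - 1 / ((n : ℝ) + 1) := by
  have : (m : ℝ) ≤ n := by exact_mod_cast h
  have : 1 / ((n : ℝ) + 1) ≤ 1 / ((m : ℝ) + 1) :=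
    one_div_le_one_div_of_le (by positivity) (by linarith)
  linarith

theorem IsCarrier.exists_exact {μ : ProbabilityMeasure X} {s : Finset X} {c : X}
    (h : IsCarrier μ s c) :
    ∃ s' ⊆ s, IsCarrier μ s' c ∧ ∀ x ∈ s', 0 < (μ : Measure X).real {x} := by
  classical
  refine ⟨s.filter fun x ↦ 0 < (μ : Measure X).real {x}, Finset.filter_subset _ _,
    ⟨?_, ?_, ?_⟩, fun x hx ↦ (Finset.mem_filter.1 hx).2⟩
  · apply real_eq_zero_of_integral
    rw [integral_eq_sum_of_null h.null]
    refine Finset.sum_eq_zero fun x hx ↦ ?_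
    by_cases hp : 0 < (μ : Measure X).real {x}
    · rw [Set.indicator_of_notMem, mul_zero]
      rw [Set.mem_compl_iff, not_not]
      exact Finset.mem_filter.2 ⟨hx, hp⟩
    · rw [le_antisymm (not_lt.1 hp) measureReal_nonneg, zero_mul]
  · exact Finset.mem_filter.2 ⟨h.mem, lt_trans (by norm_num) h.half_lt⟩
  · exact (one_sub_le_of_card_le (Finset.card_filter_le _ _)).trans h.le

theorem mem_Pf_iff {μ : ProbabilityMeasure X} : μ ∈ Pf X ↔ ∃ s c, IsCarrier μ s c := by
  constructor
  · rintro ⟨s, ⟨h0, _⟩, c, hc, hle⟩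
    exact ⟨s, c, by rw [ProbabilityMeasure.measureReal_eq_coe_coeFn, h0]; rfl, hc, by
      rwa [ProbabilityMeasure.measureReal_eq_coe_coeFn]⟩
  · rintro ⟨s, c, h⟩
    obtain ⟨s', -, h', hpos⟩ := h.exists_exact
    refine ⟨s', ⟨?_, fun x hx ↦ ?_⟩, c, h'.mem, ?_⟩
    · have := h'.null
      rw [ProbabilityMeasure.measureReal_eq_coe_coeFn] at this
      exact_mod_cast this
    · have := hpos x hx
      rw [ProbabilityMeasure.measureReal_eq_coe_coeFn] at this
      exact_mod_cast this
    · have := h'.le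
      rwa [ProbabilityMeasure.measureReal_eq_coe_coeFn] at this

/-- A finite carrier of `μ`, by choice. -/
noncomputable def Pf.supp (μ : Pf X) : Finset X := (mem_Pf_iff.1 μ.2).choose

/-- The centre of `μ`: the unique point of mass greater than `1 / 2`. -/
noncomputable def Pf.ctr (μ : Pf X) : X := (mem_Pf_iff.1 μ.2).choose_spec.choose

theorem Pf.isCarrier (μ : Pf X) : IsCarrier μ.1 (Pf.supp μ) (Pf.ctr μ) :=
  (mem_Pf_iff.1 μ.2).choose_spec.choose_spec

theorem Pf.ctr_eq_of_half_lt {μ : Pf X} {c : X} (h : 1 / 2 < (μ.1 : Measure X).real {c}) :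
    Pf.ctr μ = c :=
  eq_of_half_lt (Pf.isCarrier μ).half_lt h

theorem Pf.ctr_eq {μ : Pf X} {s : Finset X} {c : X} (h : IsCarrier μ.1 s c) : Pf.ctr μ = c :=
  Pf.ctr_eq_of_half_lt h.half_lt

theorem exists_probabilityMeasure_integral_eq {ι : Type*} (s : Finset ι) (w : ι → ℝ)
    (hw : ∀ i ∈ s, 0 ≤ w i) (hs : ∑ i ∈ s, w i = 1) (x : ι → X) :
    ∃ μ : ProbabilityMeasure X, ∀ φ : X → ℝ,
      ∫ y, φ y ∂(μ : Measure X) = ∑ i ∈ s, w i * φ (x i) := by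
  let m : Measure X := ∑ i ∈ s, (w i).toNNReal • Measure.dirac (x i)
  have hm : IsProbabilityMeasure m := by
    constructor
    simp only [m, Measure.coe_finsetSum, Finset.sum_apply, Measure.smul_apply, measure_univ]
    have : ∑ i ∈ s, (w i).toNNReal = 1 := by
      rw [← NNReal.coe_inj, NNReal.coe_sum, NNReal.coe_one, ← hs]
      exact Finset.sum_congr rfl fun i hi ↦ Real.coe_toNNReal _ (hw i hi)
    simp only [ENNReal.smul_def, smul_eq_mul, mul_one]
    rw [← ENNReal.ofNNReal_finsetSum, this, ENNReal.coe_one]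
  refine ⟨⟨m, hm⟩, fun φ ↦ ?_⟩
  change ∫ y, φ y ∂m = _
  have hint : ∀ i ∈ s, Integrable φ ((w i).toNNReal • Measure.dirac (x i)) := fun i _ ↦
    (integrable_dirac (by simp)).smul_measure_nnreal
  rw [integral_finsetSum_measure hint]
  refine Finset.sum_congr rfl fun i hi ↦ ?_
  rw [integral_smul_nnreal_measure, integral_dirac, NNReal.smul_def, Real.coe_toNNReal _ (hw i hi),
    smul_eq_mul]

variable {X' : Type*} [MeasurableSpace X'] [MeasurableSingletonClass X']

/-- Existence of the measure in the definition of `Pf.mix`. -/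
theorem exists_mix_aux (μ : ProbabilityMeasure X) (s : Finset X) (c : X) (h : IsCarrier μ s c)
    (η : X → unitInterval) (ρ : X → X') :
    ∃ ν : ProbabilityMeasure X', ∀ φ : X' → ℝ, ∫ y, φ y ∂(ν : Measure X') =
      ∫ x, ((η x : ℝ) * φ (ρ x) + (1 - η x) * φ (ρ c)) ∂(μ : Measure X) := by
  classical
  obtain ⟨ν, hν⟩ := exists_probabilityMeasure_integral_eq (s ×ˢ (Finset.univ : Finset Bool))
    (fun p ↦ (μ : Measure X).real {p.1} * (if p.2 then (η p.1 : ℝ) else 1 - η p.1))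
    (fun p _ ↦ mul_nonneg measureReal_nonneg (by
      split_ifs
      exacts [(η p.1).2.1, sub_nonneg.2 (η p.1).2.2]))
    (by
      rw [Finset.sum_product]
      refine (Finset.sum_congr rfl fun x _ ↦ ?_).trans (sum_real_singleton_of_null h.null)
      rw [Fintype.sum_bool, if_pos rfl, if_neg Bool.false_ne_true]
      ring)
    (fun p ↦ if p.2 then ρ p.1 else ρ c)
  refine ⟨ν, fun φ ↦ ?_⟩
  rw [hν, integral_eq_sum_of_null h.null, Finset.sum_product]
  refine Finset.sum_congr rfl fun x _ ↦ ?_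
  rw [Fintype.sum_bool]
  simp
  ring

theorem real_singleton_le_of_integral_eq {μ : ProbabilityMeasure X} {s : Finset X} {c : X}
    (h : IsCarrier μ s c) {η : X → unitInterval} {ρ : X → X'} {ν : ProbabilityMeasure X'}
    (hν : ∀ φ : X' → ℝ, ∫ y, φ y ∂(ν : Measure X') =
      ∫ x, ((η x : ℝ) * φ (ρ x) + (1 - η x) * φ (ρ c)) ∂(μ : Measure X)) :
    (μ : Measure X).real {c} ≤ (ν : Measure X').real {ρ c} := by
  rw [← integral_indicator_one (measurableSet_singleton (ρ c)), hν,
    integral_eq_sum_of_null h.null]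
  have h3 : ∀ x, 0 ≤ (μ : Measure X).real {x} * ((η x : ℝ) * ({ρ c} : Set X').indicator 1 (ρ x) +
      (1 - η x) * ({ρ c} : Set X').indicator 1 (ρ c)) := fun x ↦ by
    have := (η x).2.1
    have := sub_nonneg.2 (η x).2.2
    have h4 : ∀ y : X', (0 : ℝ) ≤ ({ρ c} : Set X').indicator 1 y := fun y ↦
      Set.indicator_nonneg (fun _ _ ↦ zero_le_one) y
    have := h4 (ρ x)
    have := h4 (ρ c)
    have : (0 : ℝ) ≤ (μ : Measure X).real {x} := measureReal_nonneg
    positivity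
  refine le_trans (le_of_eq ?_) (Finset.single_le_sum (fun x _ ↦ h3 x) h.mem)
  simp

theorem isCarrier_of_integral_eq [DecidableEq X'] {μ : ProbabilityMeasure X} {s : Finset X} {c : X}
    (h : IsCarrier μ s c) {η : X → unitInterval} {ρ : X → X'} {ν : ProbabilityMeasure X'}
    (hν : ∀ φ : X' → ℝ, ∫ y, φ y ∂(ν : Measure X') =
      ∫ x, ((η x : ℝ) * φ (ρ x) + (1 - η x) * φ (ρ c)) ∂(μ : Measure X)) :
    IsCarrier ν (s.image ρ) (ρ c) := by
  have hc := Finset.mem_image_of_mem ρ h.mem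
  refine ⟨?_, hc, ?_⟩
  · apply real_eq_zero_of_integral
    rw [hν, integral_eq_sum_of_null h.null]
    refine Finset.sum_eq_zero fun x hx ↦ ?_
    have h1 : ρ x ∉ ((s.image ρ : Finset X') : Set X')ᶜ := fun h' ↦
      h' (Finset.mem_image_of_mem ρ hx)
    have h2 : ρ c ∉ ((s.image ρ : Finset X') : Set X')ᶜ := fun h' ↦ h' hc
    rw [Set.indicator_of_notMem h1, Set.indicator_of_notMem h2]
    simp
  · exact (one_sub_le_of_card_le Finset.card_image_le).trans
      (h.le.trans (real_singleton_le_of_integral_eq h hν))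

/-- The basic operation on `Pf`: of the mass of `μ` at `x`, the fraction `η x` is moved to `ρ x` and
the rest to `ρ c`, where `c` is the centre of `μ`. The number of points does not grow and the mass of
the centre does not drop, so the result is again in `Pf`, for arbitrary functions `η` and `ρ`. -/
noncomputable def Pf.mix (μ : Pf X) (η : X → unitInterval) (ρ : X → X') : Pf X' :=
  ⟨(exists_mix_aux μ.1 (Pf.supp μ) (Pf.ctr μ) (Pf.isCarrier μ) η ρ).choose, by
    classical
    exact mem_Pf_iff.2 ⟨_, _, isCarrier_of_integral_eq (Pf.isCarrier μ)
      (exists_mix_aux μ.1 (Pf.supp μ) (Pf.ctr μ) (Pf.isCarrier μ) η ρ).choose_spec⟩⟩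

theorem Pf.integral_mix (μ : Pf X) (η : X → unitInterval) (ρ : X → X') (φ : X' → ℝ) :
    ∫ y, φ y ∂((Pf.mix μ η ρ).1 : Measure X') =
      ∫ x, ((η x : ℝ) * φ (ρ x) + (1 - η x) * φ (ρ (Pf.ctr μ))) ∂(μ.1 : Measure X) :=
  (exists_mix_aux μ.1 (Pf.supp μ) (Pf.ctr μ) (Pf.isCarrier μ) η ρ).choose_spec φ

theorem Pf.isCarrier_mix [DecidableEq X'] {μ : Pf X} {s : Finset X} {c : X}
    (h : IsCarrier μ.1 s c) (η : X → unitInterval) (ρ : X → X') :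
    IsCarrier (Pf.mix μ η ρ).1 (s.image ρ) (ρ c) := by
  have hc := Pf.ctr_eq h
  subst hc
  exact isCarrier_of_integral_eq h (Pf.integral_mix μ η ρ)

theorem Pf.ctr_mix (μ : Pf X) (η : X → unitInterval) (ρ : X → X') :
    Pf.ctr (Pf.mix μ η ρ) = ρ (Pf.ctr μ) := by
  classical
  exact Pf.ctr_eq (Pf.isCarrier_mix (Pf.isCarrier μ) η ρ)

theorem Pf.mix_eq_self {μ : Pf X} {s : Finset X} (hs : (μ.1 : Measure X).real (s : Set X)ᶜ = 0)
    {η : X → unitInterval} {ρ : X → X} (hη : ∀ x ∈ s, η x = 1) (hρ : ∀ x ∈ s, ρ x = x) :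
    Pf.mix μ η ρ = μ := by
  refine Subtype.ext (ext_of_forall_integral_eq fun φ ↦ ?_)
  rw [Pf.integral_mix, integral_eq_sum_of_null hs, integral_eq_sum_of_null hs]
  refine Finset.sum_congr rfl fun x hx ↦ ?_
  simp [hη x hx, hρ x hx]

theorem isCarrier_dirac (x : X) : IsCarrier (⟨Measure.dirac x, inferInstance⟩ :
    ProbabilityMeasure X) {x} x := by
  refine ⟨?_, by simp, ?_⟩
  · simp [Measure.real]
  · simp [Measure.real]

/-- Point masses, as elements of `Pf X`. -/
noncomputable def Pf.dirac (x : X) : Pf X :=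
  ⟨⟨Measure.dirac x, inferInstance⟩, mem_Pf_iff.2 ⟨{x}, x, isCarrier_dirac x⟩⟩

theorem Pf.ctr_dirac (x : X) : Pf.ctr (Pf.dirac x) = x :=
  Pf.ctr_eq (μ := Pf.dirac x) (isCarrier_dirac x)

theorem Pf.integral_dirac (x : X) (φ : X → ℝ) :
    ∫ y, φ y ∂((Pf.dirac x).1 : Measure X) = φ x := MeasureTheory.integral_dirac φ x

theorem Pf.mul_le_integral (μ : Pf X) (x : X) {f : X → ℝ} (hf : ∀ x, 0 ≤ f x) :
    (μ.1 : Measure X).real {x} * f x ≤ ∫ y, f y ∂(μ.1 : Measure X) := by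
  classical
  rw [integral_eq_sum_of_null (Pf.isCarrier μ).null]
  have hnn : ∀ y, 0 ≤ (μ.1 : Measure X).real {y} * f y := fun y ↦
    mul_nonneg measureReal_nonneg (hf y)
  by_cases hx : x ∈ Pf.supp μ
  · exact Finset.single_le_sum (f := fun y ↦ (μ.1 : Measure X).real {y} * f y)
      (fun y _ ↦ hnn y) hx
  · have : (μ.1 : Measure X).real {x} = 0 := by
      refine le_antisymm ?_ measureReal_nonneg
      rw [← (Pf.isCarrier μ).null]
      exact measureReal_mono (by simpa using hx)
    rw [this, zero_mul]
    exact Finset.sum_nonneg fun y _ ↦ hnn y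

theorem Pf.abs_integral_sub_le (μ : Pf X) {f : X → ℝ} {C : ℝ}
    (hf : ∀ x, |f x - f (Pf.ctr μ)| ≤ C) :
    |∫ x, f x ∂(μ.1 : Measure X) - f (Pf.ctr μ)| ≤
      (1 - (μ.1 : Measure X).real {Pf.ctr μ}) * C := by
  classical
  have h := Pf.isCarrier μ
  have h1 := sum_real_singleton_of_null h.null
  have h2 : ∫ x, f x ∂(μ.1 : Measure X) - f (Pf.ctr μ) =
      ∑ x ∈ Pf.supp μ, (μ.1 : Measure X).real {x} * (f x - f (Pf.ctr μ)) := by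
    simp only [mul_sub, Finset.sum_sub_distrib]
    rw [integral_eq_sum_of_null h.null, ← Finset.sum_mul, h1, one_mul]
  rw [← Finset.add_sum_erase _ _ h.mem] at h1 h2
  rw [h2, sub_self, mul_zero, zero_add, ← h1, add_sub_cancel_left, Finset.sum_mul]
  refine (Finset.abs_sum_le_sum_abs _ _).trans (Finset.sum_le_sum fun x _ ↦ ?_)
  rw [abs_mul, abs_of_nonneg measureReal_nonneg]
  exact mul_le_mul_of_nonneg_left (hf x) measureReal_nonneg

theorem isCarrier_image_of_integral_eq_sum [DecidableEq X] {μ : ProbabilityMeasure X} {p : ℕ}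
    {x : Fin p → X} {w : Fin p → ℝ} (hw : ∀ i, 0 ≤ w i) {j : Fin p}
    (hj : (1 : ℝ) - 1 / ((p : ℝ) + 1) ≤ w j)
    (hμ : ∀ φ : X → ℝ, ∫ y, φ y ∂(μ : Measure X) = ∑ i, w i * φ (x i)) :
    (Finset.univ.image x).card ≤ p ∧ IsCarrier μ (Finset.univ.image x) (x j) := by
  have hcard : (Finset.univ.image x).card ≤ p := by
    simpa using Finset.card_image_le (s := Finset.univ) (f := x)
  refine ⟨hcard, ?_, by simp, ?_⟩
  · apply real_eq_zero_of_integral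
    rw [hμ]
    exact Finset.sum_eq_zero fun i _ ↦ by simp
  · refine (one_sub_le_of_card_le hcard).trans (le_trans hj ?_)
    rw [← integral_indicator_one (measurableSet_singleton (x j)), hμ]
    have hnn : ∀ i, 0 ≤ w i * ({x j} : Set X).indicator 1 (x i) := fun i ↦
      mul_nonneg (hw i) (Set.indicator_nonneg (fun _ _ ↦ zero_le_one) _)
    refine le_trans (le_of_eq ?_) (Finset.single_le_sum (fun i _ ↦ hnn i) (Finset.mem_univ j))
    simp

/-- Measures with the same carrier and the same centre may be averaged. -/
theorem IsCarrier.exists_combination {μ ν : ProbabilityMeasure X} {s : Finset X} {c : X}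
    (hμ : IsCarrier μ s c) (hν : IsCarrier ν s c) (b : unitInterval) :
    ∃ κ : ProbabilityMeasure X, IsCarrier κ s c ∧ ∀ φ : X → ℝ, ∫ x, φ x ∂(κ : Measure X) =
      (1 - b) * ∫ x, φ x ∂(μ : Measure X) + b * ∫ x, φ x ∂(ν : Measure X) := by
  have hb := b.2.1
  have hb' := sub_nonneg.2 b.2.2
  obtain ⟨κ, hκ⟩ := exists_probabilityMeasure_integral_eq s
    (fun x ↦ (1 - b) * (μ : Measure X).real {x} + b * (ν : Measure X).real {x})
    (fun x _ ↦ add_nonneg (mul_nonneg hb' measureReal_nonneg) (mul_nonneg hb measureReal_nonneg))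
    (by
      rw [Finset.sum_add_distrib, ← Finset.mul_sum, ← Finset.mul_sum,
        sum_real_singleton_of_null hμ.null, sum_real_singleton_of_null hν.null]
      ring) id
  have hκ' : ∀ φ : X → ℝ, ∫ x, φ x ∂(κ : Measure X) =
      (1 - b) * ∫ x, φ x ∂(μ : Measure X) + b * ∫ x, φ x ∂(ν : Measure X) := by
    intro φ
    rw [hκ, integral_eq_sum_of_null hμ.null, integral_eq_sum_of_null hν.null, Finset.mul_sum,
      Finset.mul_sum, ← Finset.sum_add_distrib]
    refine Finset.sum_congr rfl fun x _ ↦ ?_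
    simp only [id]
    ring
  refine ⟨κ, ⟨?_, hμ.mem, ?_⟩, hκ'⟩
  · apply real_eq_zero_of_integral
    rw [hκ', integral_indicator_one s.measurableSet.compl,
      integral_indicator_one s.measurableSet.compl, hμ.null, hν.null]
    ring
  · have := hκ' (({c} : Set X).indicator 1)
    rw [integral_indicator_one (measurableSet_singleton c),
      integral_indicator_one (measurableSet_singleton c),
      integral_indicator_one (measurableSet_singleton c)] at this
    rw [this]
    nlinarith [hμ.le, hν.le]

/-- The elements of `Pf X` carried by at most `n` points of `A`. -/
def PfOn (A : Set X) (n : ℕ) : Set (Pf X) :=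
  {μ | ∃ s : Finset X, s.card ≤ n ∧ (s : Set X) ⊆ A ∧ IsCarrier μ.1 s (Pf.ctr μ)}

theorem PfOn_mono {A B : Set X} (h : A ⊆ B) {m n : ℕ} (hmn : m ≤ n) : PfOn A m ⊆ PfOn B n :=
  fun _ ⟨s, hsm, hsA, hs⟩ ↦ ⟨s, hsm.trans hmn, hsA.trans h, hs⟩

theorem mem_PfOn_of_isCarrier {A : Set X} {n : ℕ} {μ : Pf X} {s : Finset X} {c : X}
    (h : IsCarrier μ.1 s c) (hs : s.card ≤ n) (hA : (s : Set X) ⊆ A) : μ ∈ PfOn A n :=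
  ⟨s, hs, hA, by rwa [Pf.ctr_eq h]⟩

theorem Pf.mix_mem_PfOn {A : Set X} {B : Set X'} {n : ℕ} {μ : Pf X} (h : μ ∈ PfOn A n)
    (η : X → unitInterval) {ρ : X → X'} (hρ : Set.MapsTo ρ A B) :
    Pf.mix μ η ρ ∈ PfOn B n := by
  classical
  obtain ⟨s, hs, hsA, hc⟩ := h
  refine mem_PfOn_of_isCarrier (Pf.isCarrier_mix hc η ρ) (Finset.card_image_le.trans hs) ?_
  rw [Finset.coe_image]
  exact (Set.image_mono hsA).trans hρ.image_subset

theorem Pf.dirac_mem_PfOn {A : Set X} {x : X} (hx : x ∈ A) {n : ℕ} (hn : 1 ≤ n) :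
    Pf.dirac x ∈ PfOn A n :=
  mem_PfOn_of_isCarrier (μ := Pf.dirac x) (isCarrier_dirac x) (by simpa using hn)
    (by simpa using hx)

end Carrier

section Continuity

variable {X : Type*} [TopologicalSpace X] [CompactSpace X] [MeasurableSpace X]
  [BorelSpace X]

theorem Pf.continuous_iff {P : Type*} [TopologicalSpace P] {F : P → Pf X} :
    Continuous F ↔ ∀ φ : C(X, ℝ), Continuous fun p ↦ ∫ x, φ x ∂((F p).1 : Measure X) := by
  rw [← ProbabilityMeasure.continuous_iff_forall_continuousMap_continuous_integral
    (μs := fun p ↦ (F p).1)]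
  exact continuous_induced_rng

/-- Integration is jointly continuous in the measure and in the function, as `X` is compact. -/
theorem continuous_integral_param {P : Type*} [TopologicalSpace P] {F : P → Pf X}
    (hF : Continuous F) {ψ : P → X → ℝ} (hψ : Continuous (Function.uncurry ψ)) :
    Continuous fun p ↦ ∫ x, ψ p x ∂((F p).1 : Measure X) := by
  let Ψ : C(P, C(X, ℝ)) := ContinuousMap.curry ⟨Function.uncurry ψ, hψ⟩
  have hΨ : ∀ p x, Ψ p x = ψ p x := fun _ _ ↦ rfl
  rw [continuous_iff_continuousAt]
  intro p₀
  have h1 : Continuous fun p ↦ ∫ x, Ψ p₀ x ∂((F p).1 : Measure X) := Pf.continuous_iff.1 hF _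
  have hint : ∀ p (f : C(X, ℝ)), Integrable f ((F p).1 : Measure X) := fun p f ↦
    f.continuous.integrable_of_hasCompactSupport (HasCompactSupport.of_compactSpace f)
  have h2 : Filter.Tendsto (fun p ↦ ∫ x, (Ψ p - Ψ p₀) x ∂((F p).1 : Measure X)) (𝓝 p₀) (𝓝 0) := by
    have hb : ∀ p, ‖∫ x, (Ψ p - Ψ p₀) x ∂((F p).1 : Measure X)‖ ≤ ‖Ψ p - Ψ p₀‖ := fun p ↦ by
      have := norm_integral_le_of_norm_le_const (μ := ((F p).1 : Measure X)) (f := (Ψ p - Ψ p₀))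
        (C := ‖Ψ p - Ψ p₀‖) (Filter.Eventually.of_forall fun x ↦
          ContinuousMap.norm_coe_le_norm _ x)
      simpa using this
    refine squeeze_zero_norm hb ?_
    have : Continuous fun p ↦ ‖Ψ p - Ψ p₀‖ := by fun_prop
    simpa using this.tendsto p₀
  have h3 := h2.add (h1.tendsto p₀)
  rw [zero_add] at h3
  refine h3.congr fun p ↦ ?_
  simp only [ContinuousMap.sub_apply]
  rw [integral_sub (hint p _) (hint p _)]
  simp [hΨ]

theorem Pf.tendsto_iff {P : Type*} {l : Filter P} {F : P → Pf X} {μ : Pf X} :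
    Filter.Tendsto F l (𝓝 μ) ↔ ∀ φ : C(X, ℝ), Filter.Tendsto
      (fun p ↦ ∫ x, φ x ∂((F p).1 : Measure X)) l (𝓝 (∫ x, φ x ∂(μ.1 : Measure X))) := by
  rw [IsEmbedding.subtypeVal.tendsto_nhds_iff,
    ProbabilityMeasure.tendsto_iff_forall_integral_tendsto]
  exact (ContinuousMap.equivBoundedOfCompact X ℝ).symm.forall_congr_left

variable [T2Space X]

theorem Pf.continuous_dirac : Continuous (Pf.dirac : X → Pf X) := by
  refine Pf.continuous_iff.2 fun φ ↦ ?_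
  simp only [Pf.integral_dirac]
  exact φ.continuous

/-- A continuous function that is `1` at the centre and `0` outside a neighbourhood of it has
integral greater than `1 / 2`, and this forces the centre of nearby measures into the
neighbourhood. -/
theorem Pf.continuous_ctr : Continuous (Pf.ctr : Pf X → X) := by
  rw [continuous_iff_continuousAt]
  intro μ U hU
  obtain ⟨V, hVU, hV, hxV⟩ := mem_nhds_iff.1 hU
  obtain ⟨φ, hφ0, hφ1, hφ⟩ := exists_continuous_zero_one_of_isClosed hV.isClosed_compl
    (isClosed_singleton (x := Pf.ctr μ)) (by simpa using hxV)
  have hφc : φ (Pf.ctr μ) = 1 := hφ1 rfl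
  have h1 : 1 / 2 < ∫ x, φ x ∂(μ.1 : Measure X) := by
    refine (Pf.isCarrier μ).half_lt.trans_le ?_
    have := Pf.mul_le_integral μ (Pf.ctr μ) fun x ↦ (hφ x).1
    rwa [hφc, mul_one] at this
  have h2 : Continuous fun ν : Pf X ↦ ∫ x, φ x ∂(ν.1 : Measure X) :=
    Pf.continuous_iff.1 continuous_id φ
  have h5 : ∀ᶠ ν in 𝓝 μ, 1 / 2 < ∫ x, φ x ∂(ν.1 : Measure X) :=
    h2.continuousAt.eventually_const_lt h1
  refine Filter.mem_map.2 (Filter.mem_of_superset h5 fun ν hν ↦ ?_)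
  refine hVU (by_contra fun hn ↦ ?_)
  change 1 / 2 < ∫ x, φ x ∂(ν.1 : Measure X) at hν
  have h3 : φ (Pf.ctr ν) = 0 := hφ0 hn
  have h4 := Pf.abs_integral_sub_le ν (f := φ) (C := 1) fun x ↦ by
    rw [h3, sub_zero, abs_of_nonneg (hφ x).1]
    exact (hφ x).2
  rw [h3, sub_zero, mul_one] at h4
  have := (le_abs_self _).trans h4
  have := (Pf.isCarrier ν).half_lt
  linarith

/-- Only the product of `η` and the test functions composed with `ρ` has to be continuous, so `ρ` may
be discontinuous where `η` vanishes. -/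
theorem Pf.continuous_mix {X' : Type*} [TopologicalSpace X'] [CompactSpace X'] [T2Space X']
    [MeasurableSpace X'] [BorelSpace X'] {P : Type*} [TopologicalSpace P] {F : P → Pf X}
    (hF : Continuous F) {η : P → X → unitInterval} (hη : Continuous (Function.uncurry η))
    {ρ : P → X → X'} (hρ : ∀ φ : C(X', ℝ),
      Continuous fun p : P × X ↦ (η p.1 p.2 : ℝ) * φ (ρ p.1 p.2))
    (hc : Continuous fun p ↦ ρ p (Pf.ctr (F p))) :
    Continuous fun p ↦ Pf.mix (F p) (η p) (ρ p) := by
  refine Pf.continuous_iff.2 fun φ ↦ ?_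
  simp only [Pf.integral_mix]
  refine continuous_integral_param hF (ψ := fun p x ↦ (η p x : ℝ) * φ (ρ p x) +
    (1 - η p x) * φ (ρ p (Pf.ctr (F p)))) ?_
  have h1 : Continuous fun p : P × X ↦ (η p.1 p.2 : ℝ) := continuous_subtype_val.comp hη
  have h2 : Continuous fun p : P × X ↦ φ (ρ p.1 (Pf.ctr (F p.1))) :=
    φ.continuous.comp (hc.comp continuous_fst)
  exact (hρ φ).add ((continuous_const.sub h1).mul h2)

theorem isCompact_tuples {A : Set X} (hA : IsClosed A) (p : ℕ) (j : Fin p) :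
    IsCompact {μ : Pf X | ∃ x : Fin p → X, (∀ i, x i ∈ A) ∧ ∃ w ∈ stdSimplex ℝ (Fin p),
      (1 : ℝ) - 1 / ((p : ℝ) + 1) ≤ w j ∧
      ∀ φ : X → ℝ, ∫ y, φ y ∂(μ.1 : Measure X) = ∑ i, w i * φ (x i)} := by
  classical
  let T : Set ((Fin p → X) × (Fin p → ℝ)) := {x | ∀ i, x i ∈ A} ×ˢ
    (stdSimplex ℝ (Fin p) ∩ {w | (1 : ℝ) - 1 / ((p : ℝ) + 1) ≤ w j})
  have hT : IsCompact T := by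
    refine IsCompact.prod ?_ ((isCompact_stdSimplex _ _).inter_right
      (isClosed_le continuous_const (continuous_apply j)))
    have : {x : Fin p → X | ∀ i, x i ∈ A} = Set.univ.pi fun _ ↦ A := by
      ext
      simp
    rw [this]
    exact (isClosed_set_pi fun _ _ ↦ hA).isCompact
  have hex : ∀ q : T, ∃ μ : Pf X, ∀ φ : X → ℝ,
      ∫ y, φ y ∂(μ.1 : Measure X) = ∑ i, q.1.2 i * φ (q.1.1 i) := by
    rintro ⟨⟨x, w⟩, hx, hw, hj⟩
    obtain ⟨μ, hμ⟩ := exists_probabilityMeasure_integral_eq Finset.univ w (fun i _ ↦ hw.1 i)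
      hw.2 x
    exact ⟨⟨μ, mem_Pf_iff.2 ⟨_, _, (isCarrier_image_of_integral_eq_sum hw.1 hj hμ).2⟩⟩, hμ⟩
  choose G hG using hex
  have hGc : Continuous G := by
    refine Pf.continuous_iff.2 fun φ ↦ ?_
    simp only [hG]
    fun_prop
  have : CompactSpace T := isCompact_iff_compactSpace.1 hT
  convert isCompact_range hGc using 1
  ext μ
  constructor
  · rintro ⟨x, hx, w, hw, hj, hμ⟩
    refine ⟨⟨(x, w), hx, hw, hj⟩, Subtype.ext (ext_of_forall_integral_eq fun φ ↦ ?_)⟩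
    rw [hG, hμ]
  · rintro ⟨⟨⟨x, w⟩, hx, hw, hj⟩, rfl⟩
    exact ⟨x, hx, w, hw, hj, hG _⟩

/-- `PfOn A n` is a finite union of continuous images of compact sets of tuples of points and
weights. -/
theorem isCompact_PfOn {A : Set X} (hA : IsClosed A) (n : ℕ) : IsCompact (PfOn A n) := by
  classical
  have key : PfOn A n = ⋃ p ∈ Finset.range (n + 1), ⋃ j : Fin p,
      {μ : Pf X | ∃ x : Fin p → X, (∀ i, x i ∈ A) ∧ ∃ w ∈ stdSimplex ℝ (Fin p),
        (1 : ℝ) - 1 / ((p : ℝ) + 1) ≤ w j ∧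
        ∀ φ : X → ℝ, ∫ y, φ y ∂(μ.1 : Measure X) = ∑ i, w i * φ (x i)} := by
    ext μ
    simp only [Set.mem_iUnion, Finset.mem_range, Set.mem_ofPred_eq]
    constructor
    · rintro ⟨s, hsn, hsA, hs⟩
      let e := s.equivFin
      refine ⟨s.card, by omega, e ⟨_, hs.mem⟩, fun i ↦ e.symm i, fun i ↦ hsA (e.symm i).2,
        fun i ↦ (μ.1 : Measure X).real {(e.symm i : X)},
        ⟨fun i ↦ measureReal_nonneg, ?_⟩, by simpa using hs.le, fun φ ↦ ?_⟩
      · rw [← sum_real_singleton_of_null hs.null, ← Finset.sum_coe_sort s]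
        exact Equiv.sum_comp e.symm fun y : s ↦ (μ.1 : Measure X).real {(y : X)}
      · rw [integral_eq_sum_of_null hs.null, ← Finset.sum_coe_sort s]
        exact (Equiv.sum_comp e.symm fun y : s ↦ (μ.1 : Measure X).real {(y : X)} * φ y).symm
    · rintro ⟨p, hp, j, x, hx, w, hw, hj, hμ⟩
      obtain ⟨hcard, hcar⟩ := isCarrier_image_of_integral_eq_sum hw.1 hj hμ
      refine ⟨Finset.univ.image x, by omega, by simpa [Set.range_subset_iff] using hx, ?_⟩
      rwa [Pf.ctr_eq hcar]
  rw [key]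
  exact (Finset.range (n + 1)).isCompact_biUnion fun p _ ↦
    isCompact_iUnion fun j ↦ isCompact_tuples hA p j

/-- The number of atoms is lower semicontinuous. -/
theorem Pf.eventually_card_le {μ : Pf X} {s : Finset X}
    (hpos : ∀ x ∈ s, 0 < (μ.1 : Measure X).real {x}) :
    ∀ᶠ ν in 𝓝 μ, s.card ≤ (Pf.supp ν).card := by
  classical
  obtain ⟨U, hU, hUd⟩ := s.finite_toSet.t2_separation
  have hf : ∀ x, ∃ f : C(X, ℝ), Set.EqOn f 0 (U x)ᶜ ∧ Set.EqOn f 1 {x} ∧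
      ∀ y, f y ∈ Set.Icc (0 : ℝ) 1 := fun x ↦
    exists_continuous_zero_one_of_isClosed (hU x).2.isClosed_compl isClosed_singleton
      (by simpa using (hU x).1)
  choose f hf0 hf1 hf using hf
  have hev : ∀ᶠ ν in 𝓝 μ, ∀ x ∈ s, 0 < ∫ y, f x y ∂(ν.1 : Measure X) := by
    refine (Filter.eventually_all_finset s).2 fun x hx ↦ ?_
    have h1 : Continuous fun ν : Pf X ↦ ∫ y, f x y ∂(ν.1 : Measure X) :=
      Pf.continuous_iff.1 continuous_id _
    refine h1.continuousAt.eventually_const_lt ((hpos x hx).trans_le ?_)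
    have h2 := Pf.mul_le_integral μ x fun y ↦ (hf x y).1
    rwa [hf1 x rfl, Pi.one_apply, mul_one] at h2
  filter_upwards [hev] with ν hν
  have hex : ∀ x ∈ s, ∃ y ∈ Pf.supp ν, y ∈ U x := by
    intro x hx
    by_contra! h
    refine (hν x hx).ne' ?_
    rw [integral_eq_sum_of_null (Pf.isCarrier ν).null]
    exact Finset.sum_eq_zero fun y hy ↦ by rw [hf0 x (h y hy), Pi.zero_apply, mul_zero]
  choose! g hgs hgU using hex
  refine Finset.card_le_card_of_injOn g hgs fun x hx y hy hxy ↦ ?_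
  by_contra hne
  exact Set.disjoint_left.1 (hUd hx hy hne) (hgU x hx) (hxy ▸ hgU y hy)

/-- Along an ultrafilter either the number of points is bounded, and `isCompact_PfOn` applies, or it
tends to infinity; then the mass of the centre tends to `1`, and the measures converge to a point
mass. -/
instance Pf.compactSpace : CompactSpace (Pf X) := by
  refine ⟨isCompact_iff_ultrafilter_le_nhds.2 fun f _ ↦ ?_⟩
  by_cases h : ∃ n, PfOn (Set.univ : Set X) n ∈ f
  · obtain ⟨n, hn⟩ := h
    obtain ⟨μ, -, hμ⟩ := isCompact_iff_ultrafilter_le_nhds.1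
      (isCompact_PfOn (X := X) isClosed_univ n) f (Filter.le_principal_iff.2 hn)
    exact ⟨μ, trivial, hμ⟩
  · push Not at h
    obtain ⟨x, -, hx⟩ := isCompact_iff_ultrafilter_le_nhds.1 (isCompact_univ (X := X))
      (f.map Pf.ctr) (by simp)
    have hctr : Filter.Tendsto Pf.ctr f (𝓝 x) := hx
    refine ⟨Pf.dirac x, trivial, ?_⟩
    change Filter.Tendsto id f (𝓝 (Pf.dirac x))
    refine Pf.tendsto_iff.2 fun φ ↦ ?_
    rw [Pf.integral_dirac]
    have h1 : Filter.Tendsto (fun μ : Pf X ↦ φ (Pf.ctr μ)) f (𝓝 (φ x)) :=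
      (φ.continuous.tendsto x).comp hctr
    have h2 : Filter.Tendsto (fun μ : Pf X ↦ ∫ y, φ y ∂(μ.1 : Measure X) - φ (Pf.ctr μ)) f
        (𝓝 0) := by
      have h3 : Filter.Tendsto (fun μ : Pf X ↦ 1 - (μ.1 : Measure X).real {Pf.ctr μ}) f (𝓝 0) := by
        rw [Metric.tendsto_nhds]
        intro ε hε
        obtain ⟨n, hn⟩ := exists_nat_one_div_lt hε
        filter_upwards [Ultrafilter.compl_mem_iff_notMem.2 (h n)] with μ hμ
        have hcard : n ≤ (Pf.supp μ).card := by
          by_contra hlt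
          exact hμ ⟨_, (not_le.1 hlt).le, Set.subset_univ _, Pf.isCarrier μ⟩
        have h4 := (one_sub_le_of_card_le hcard).trans (Pf.isCarrier μ).le
        have h5 : (μ.1 : Measure X).real {Pf.ctr μ} ≤ 1 := measureReal_le_one
        rw [Real.dist_eq, sub_zero, abs_of_nonneg (by linarith)]
        linarith
      refine squeeze_zero_norm (a := fun μ : Pf X ↦
        (1 - (μ.1 : Measure X).real {Pf.ctr μ}) * (2 * ‖φ‖)) (fun μ ↦ ?_)
        (by simpa using h3.mul_const (2 * ‖φ‖))
      refine Pf.abs_integral_sub_le μ fun y ↦ ?_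
      have h6 := ContinuousMap.norm_coe_le_norm φ y
      have h7 := ContinuousMap.norm_coe_le_norm φ (Pf.ctr μ)
      have h8 := norm_sub_le (φ y) (φ (Pf.ctr μ))
      rw [Real.norm_eq_abs (φ y - _)] at h8
      linarith
    simpa using h2.add h1

end Continuity

/-! ### Finite-dimensional pieces of `Pf Cube` -/

/-- The Hilbert cube. -/
abbrev Cube : Type := ℕ → unitInterval

/-- The `n`-dimensional face of the Hilbert cube spanned by the first `n` coordinates. -/
def face (n : ℕ) : Set Cube := {x | ∀ j, n ≤ j → x j = 0}

theorem isClosed_face (n : ℕ) : IsClosed (face n) := by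
  have : face n = ⋂ j, ⋂ (_ : n ≤ j), {x : Cube | x j = 0} := by
    ext
    simp [face]
  rw [this]
  exact isClosed_iInter fun j ↦ isClosed_iInter fun _ ↦
    isClosed_eq (continuous_apply j) continuous_const

theorem face_mono {m n : ℕ} (h : m ≤ n) : face m ⊆ face n := fun _ hx j hj ↦ hx j (h.trans hj)

/-- The origin of the Hilbert cube. -/
def zeroPt : Cube := fun _ ↦ 0

/-- The measures in `Pf Cube` carried by at most `n` points of an `n`-dimensional face: a
finite-dimensional piece of `Pf Cube`. -/
abbrev PfFace (n : ℕ) : Set (Pf Cube) := PfOn (face n) n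

instance (n : ℕ) : CompactSpace (PfFace n) :=
  isCompact_iff_compactSpace.1 (isCompact_PfOn (isClosed_face n) n)

theorem contractibleSpace_PfFace {n : ℕ} (hn : 1 ≤ n) : ContractibleSpace (PfFace n) := by
  rw [contractible_iff_id_nullhomotopic]
  have hz : zeroPt ∈ face n := fun _ _ ↦ rfl
  let ρ : unitInterval → Cube → Cube := fun t x j ↦ unitInterval.symm t * x j
  have hρ : Continuous (Function.uncurry ρ) := by
    refine continuous_pi fun j ↦ ?_
    have : Continuous fun p : unitInterval × Cube ↦ unitInterval.symm p.1 * p.2 j := by fun_prop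
    exact this
  have hρf : ∀ t, Set.MapsTo (ρ t) (face n) (face n) := fun t x hx j hj ↦ by
    simp [ρ, hx j hj]
  have hc : Continuous fun p : unitInterval × PfFace n ↦
      Pf.mix p.2.1 (fun _ ↦ 1) (ρ p.1) := by
    refine Pf.continuous_mix (F := fun p : unitInterval × PfFace n ↦ p.2.1) (η := fun _ _ ↦ 1)
      (ρ := fun p ↦ ρ p.1) (by fun_prop) continuous_const
      (fun φ ↦ ?_) ?_
    · exact continuous_const.mul (φ.continuous.comp (hρ.comp
        ((continuous_fst.comp continuous_fst).prodMk continuous_snd)))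
    · exact hρ.comp (continuous_fst.prodMk (Pf.continuous_ctr.comp
        (continuous_subtype_val.comp continuous_snd)))
  refine ⟨⟨Pf.dirac zeroPt, Pf.dirac_mem_PfOn hz hn⟩, ⟨⟨⟨fun p ↦
    ⟨Pf.mix p.2.1 (fun _ ↦ 1) (ρ p.1), Pf.mix_mem_PfOn p.2.2 _ (hρf p.1)⟩, hc.subtype_mk _⟩,
    fun μ ↦ Subtype.ext ?_, fun μ ↦ Subtype.ext ?_⟩⟩⟩
  · refine Pf.mix_eq_self (Pf.isCarrier μ.1).null (fun _ _ ↦ rfl) fun x _ ↦ ?_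
    funext j
    simp [ρ]
  · refine Subtype.ext (ext_of_forall_integral_eq fun φ ↦ ?_)
    have h1 : ∀ x, ρ 1 x = zeroPt := fun x ↦ by
      funext j
      simp [ρ, zeroPt]
    change ∫ y, φ y ∂((Pf.mix μ.1 (fun _ ↦ 1) (ρ 1)).1 : Measure Cube) =
      ∫ y, φ y ∂((Pf.dirac zeroPt).1 : Measure Cube)
    rw [Pf.integral_mix, Pf.integral_dirac]
    simp [h1]

section Moments

variable {n : ℕ}

/-- The constant function `1` and the first `n` coordinate functions. -/
def affCoord (o : Option (Fin n)) (x : Cube) : ℝ := o.elim 1 fun j ↦ (x j : ℝ)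

theorem continuous_affCoord (o : Option (Fin n)) : Continuous (affCoord o) := by
  rcases o with _ | j
  · exact continuous_const
  · change Continuous fun x : Cube ↦ (x j : ℝ)
    fun_prop

/-- Products of `2 * n` affine coordinates, that is, the monomials of degree at most `2 * n`. -/
def monomialFun (w : Fin (2 * n) → Option (Fin n)) (x : Cube) : ℝ := ∏ i, affCoord (w i) x

/-- Factors of a Lagrange interpolation polynomial. -/
theorem exists_affine_separating {a b : Cube} (ha : a ∈ face n) (hb : b ∈ face n) :
    ∃ c : Option (Fin n) → ℝ, ∑ o, c o * affCoord o a = 1 ∧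
      (b ≠ a → ∑ o, c o * affCoord o b = 0) := by
  classical
  by_cases hba : b = a
  · refine ⟨fun o ↦ if o = none then 1 else 0, ?_, fun h ↦ absurd hba h⟩
    simp [affCoord]
  · have : ∃ j : Fin n, b j ≠ a j := by
      by_contra! h
      refine hba (funext fun j ↦ ?_)
      rcases lt_or_ge j n with hj | hj
      · exact h ⟨j, hj⟩
      · rw [ha j hj, hb j hj]
    obtain ⟨j, hj⟩ := this
    have hne : (a j : ℝ) - b j ≠ 0 := fun h ↦ hj (Subtype.ext (sub_eq_zero.1 h).symm)
    refine ⟨fun o ↦ if o = none then -(b j : ℝ) / (a j - b j) else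
      if o = some j then 1 / ((a j : ℝ) - b j) else 0, ?_, fun _ ↦ ?_⟩
    all_goals
      rw [Fintype.sum_option]
      simp [affCoord]
      field_simp
      ring

/-- Two measures on the same at most `2 * n` points have equal masses if their moments of degree at most
`2 * n` agree: the mass at `a` is the integral of the Lagrange polynomial of `a`. -/
theorem real_singleton_eq_of_moments {μ ν : ProbabilityMeasure Cube} {u : Finset Cube}
    (hu : (u : Set Cube) ⊆ face n) (hcard : u.card ≤ 2 * n)
    (hμ : (μ : Measure Cube).real (u : Set Cube)ᶜ = 0)
    (hν : (ν : Measure Cube).real (u : Set Cube)ᶜ = 0)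
    (h : ∀ w : Fin (2 * n) → Option (Fin n), ∫ x, monomialFun w x ∂(μ : Measure Cube) =
      ∫ x, monomialFun w x ∂(ν : Measure Cube)) {a : Cube} (ha : a ∈ u) :
    (μ : Measure Cube).real {a} = (ν : Measure Cube).real {a} := by
  classical
  -- an enumeration of `u` of length `2 * n`
  let b : Fin (2 * n) → Cube := fun i ↦ if h : (i : ℕ) < u.card then u.equivFin.symm ⟨i, h⟩ else a
  have hbu : ∀ i, b i ∈ u := fun i ↦ by
    simp only [b]
    split_ifs
    exacts [Subtype.coe_prop _, ha]
  have hbs : ∀ y ∈ u, ∃ i, b i = y := fun y hy ↦ by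
    have hlt := (u.equivFin ⟨y, hy⟩).2
    refine ⟨⟨u.equivFin ⟨y, hy⟩, hlt.trans_le hcard⟩, ?_⟩
    simp [b]
  choose c hca hcb using fun i ↦ exists_affine_separating (hu ha) (hu (hbu i))
  let L : Cube → ℝ := fun x ↦ ∏ i, ∑ o, c i o * affCoord o x
  have hLa : L a = 1 := Finset.prod_eq_one fun i _ ↦ hca i
  have hLb : ∀ y ∈ u, y ≠ a → L y = 0 := fun y hy hya ↦ by
    obtain ⟨i, rfl⟩ := hbs y hy
    exact Finset.prod_eq_zero (Finset.mem_univ i) (hcb i hya)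
  have hLexp : ∀ x, L x = ∑ w : Fin (2 * n) → Option (Fin n),
      (∏ i, c i (w i)) * monomialFun w x := fun x ↦ by
    simp only [L, monomialFun]
    rw [Finset.prod_univ_sum, Fintype.piFinset_univ]
    exact Finset.sum_congr rfl fun w _ ↦ Finset.prod_mul_distrib
  have hint : ∀ κ : ProbabilityMeasure Cube, (κ : Measure Cube).real (u : Set Cube)ᶜ = 0 →
      ∫ x, L x ∂(κ : Measure Cube) = ∑ w : Fin (2 * n) → Option (Fin n),
        (∏ i, c i (w i)) * ∫ x, monomialFun w x ∂(κ : Measure Cube) := fun κ hκ ↦ by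
    simp only [integral_eq_sum_of_null hκ, hLexp, Finset.mul_sum]
    rw [Finset.sum_comm]
    exact Finset.sum_congr rfl fun w _ ↦ Finset.sum_congr rfl fun x _ ↦ by ring
  have hsing : ∀ κ : ProbabilityMeasure Cube, (κ : Measure Cube).real (u : Set Cube)ᶜ = 0 →
      ∫ x, L x ∂(κ : Measure Cube) = (κ : Measure Cube).real {a} := fun κ hκ ↦ by
    rw [integral_eq_sum_of_null hκ, Finset.sum_eq_single_of_mem a ha fun y hy hya ↦ by
      rw [hLb y hy hya, mul_zero], hLa, mul_one]
  rw [← hsing μ hμ, ← hsing ν hν, hint μ hμ, hint ν hν]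
  simp only [h]

theorem eq_of_moments {μ ν : Pf Cube} (hμ : μ ∈ PfFace n) (hν : ν ∈ PfFace n)
    (h : ∀ w : Fin (2 * n) → Option (Fin n), ∫ x, monomialFun w x ∂(μ.1 : Measure Cube) =
      ∫ x, monomialFun w x ∂(ν.1 : Measure Cube)) : μ = ν := by
  classical
  obtain ⟨s, hs, hsA, hsc⟩ := hμ
  obtain ⟨t, ht, htA, htc⟩ := hν
  have hnull : ∀ (κ : ProbabilityMeasure Cube) (v : Finset Cube), v ⊆ s ∪ t →
      (κ : Measure Cube).real (v : Set Cube)ᶜ = 0 →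
      (κ : Measure Cube).real ((s ∪ t : Finset Cube) : Set Cube)ᶜ = 0 := fun κ v hv hκ ↦
    le_antisymm (hκ ▸ measureReal_mono (Set.compl_subset_compl.2 (by exact_mod_cast hv)))
      measureReal_nonneg
  have h1 := hnull μ.1 s Finset.subset_union_left hsc.null
  have h2 := hnull ν.1 t Finset.subset_union_right htc.null
  have hcard : (s ∪ t).card ≤ 2 * n := (Finset.card_union_le s t).trans (by omega)
  have hA : ((s ∪ t : Finset Cube) : Set Cube) ⊆ face n := by
    rw [Finset.coe_union]
    exact Set.union_subset hsA htA
  refine Subtype.ext (ext_of_forall_integral_eq fun φ ↦ ?_)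
  rw [integral_eq_sum_of_null h1, integral_eq_sum_of_null h2]
  exact Finset.sum_congr rfl fun x hx ↦ by
    rw [real_singleton_eq_of_moments hA hcard h1 h2 h hx]

/-- Finitely many moments embed `PfFace n` into a Euclidean space. -/
theorem exists_embedding_PfFace (n : ℕ) : ∃ (N : ℕ) (e : PfFace n → Fin N → ℝ),
    Continuous e ∧ Function.Injective e := by
  let E := Fintype.equivFin (Fin (2 * n) → Option (Fin n))
  refine ⟨_, fun μ i ↦ ∫ x, monomialFun (E.symm i) x ∂(μ.1.1 : Measure Cube), ?_, fun μ ν h ↦ ?_⟩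
  · refine continuous_pi fun i ↦ ?_
    have hm : Continuous (monomialFun (E.symm i)) :=
      continuous_finsetProd _ fun l _ ↦ continuous_affCoord _
    exact Pf.continuous_iff.1 continuous_subtype_val ⟨_, hm⟩
  · refine Subtype.ext (eq_of_moments μ.2 ν.2 fun w ↦ ?_)
    have := congrFun h (E w)
    simpa using this

end Moments

/-- A homotopy `R` of the cube that starts at the identity, fixes `s` pointwise and at time `1` sends
a neighbourhood of every point of `s` to that point, and a cut-off function `η` which is `1` on `s` and
supported where `R 1` takes values in `s`. -/
theorem exists_clustering (s : Finset Cube) :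
    ∃ (R : unitInterval → Cube → Cube) (η : Cube → unitInterval),
      Continuous (Function.uncurry R) ∧ Continuous η ∧ (∀ x, R 0 x = x) ∧
      (∀ y ∈ s, ∀ t, R t y = y) ∧ (∀ y ∈ s, η y = 1) ∧ (∀ x, η x ≠ 0 → R 1 x ∈ s) ∧
      (∀ y ∈ s, ∀ᶠ x in 𝓝 y, R 1 x = y) ∧
      ∀ n, (s : Set Cube) ⊆ face n → ∀ t, Set.MapsTo (R t) (face n) (face n) := by
  classical
  obtain ⟨U, hU, hUd⟩ := s.finite_toSet.t2_separation
  have hf : ∀ y, ∃ f : C(Cube, ℝ), Set.EqOn f 0 (U y)ᶜ ∧ Set.EqOn f 1 {y} ∧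
      ∀ x, f x ∈ Set.Icc (0 : ℝ) 1 := fun y ↦
    exists_continuous_zero_one_of_isClosed (hU y).2.isClosed_compl isClosed_singleton
      (by simpa using (hU y).1)
  choose f hf0 hf1 hf using hf
  let shift : Cube → ℕ → ℝ := fun x j ↦ ∑ y ∈ s, min 1 (2 * f y x) * ((y j : ℝ) - x j)
  let R : unitInterval → Cube → Cube := fun t x j ↦
    Set.projIcc 0 1 zero_le_one ((x j : ℝ) + t * shift x j)
  let η : Cube → unitInterval := fun x ↦
    Set.projIcc 0 1 zero_le_one (∑ y ∈ s, max 0 (2 * f y x - 1))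
  have hf1' : ∀ y, f y y = 1 := fun y ↦ hf1 y rfl
  have hother : ∀ x, ∀ y ∈ s, f y x ≠ 0 → ∀ z ∈ s, z ≠ y → f z x = 0 := by
    intro x y hy hxy z hz hzy
    have hx : x ∈ U y := by_contra fun h ↦ hxy (hf0 y h)
    exact hf0 z fun h ↦ Set.disjoint_left.1 (hUd hz hy hzy) h hx
  have hshift : ∀ x, ∀ y ∈ s, 1 / 2 ≤ f y x → ∀ j, shift x j = y j - x j := by
    intro x y hy hxy j
    have hne : f y x ≠ 0 := by linarith
    simp only [shift]
    rw [Finset.sum_eq_single_of_mem y hy fun z hz hzy ↦ by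
      rw [hother x y hy hne z hz hzy]; simp, min_eq_left (by linarith), one_mul]
  have hR1 : ∀ x, ∀ y ∈ s, 1 / 2 ≤ f y x → R 1 x = y := by
    intro x y hy hxy
    funext j
    simp only [R]
    rw [hshift x y hy hxy j, Set.Icc.coe_one, one_mul, add_sub_cancel]
    exact Set.projIcc_val zero_le_one _
  have hshc : ∀ j, Continuous fun x ↦ shift x j := fun j ↦
    continuous_finsetSum _ fun y _ ↦ by fun_prop
  refine ⟨R, η, ?_, ?_, fun x ↦ ?_, fun y hy t ↦ ?_, fun y hy ↦ ?_, fun x hx ↦ ?_,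
    fun y hy ↦ ?_, fun n hs t x hx j hj ↦ ?_⟩
  · refine continuous_pi fun j ↦ continuous_projIcc.comp ?_
    have := (hshc j).comp (continuous_snd (X := unitInterval))
    simp only [Function.comp_def] at this
    fun_prop
  · exact continuous_projIcc.comp (continuous_finsetSum _ fun y _ ↦ by fun_prop)
  · funext j
    simp only [R, Set.Icc.coe_zero, zero_mul, add_zero]
    exact Set.projIcc_val zero_le_one _
  · funext j
    simp only [R]
    rw [hshift y y hy (by rw [hf1']; norm_num) j, sub_self, mul_zero, add_zero]
    exact Set.projIcc_val zero_le_one _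
  · refine Set.projIcc_of_right_le _ ?_
    refine le_trans (le_of_eq ?_) (Finset.single_le_sum (f := fun z ↦ max 0 (2 * f z y - 1))
      (fun z _ ↦ le_max_left _ _) hy)
    simp only [hf1']
    norm_num
  · have : ∃ y ∈ s, 1 / 2 ≤ f y x := by
      by_contra! h
      refine hx (Set.projIcc_of_le_left _ (le_of_eq (Finset.sum_eq_zero fun y hy ↦ ?_)))
      have := h y hy
      exact max_eq_left (by linarith)
    obtain ⟨y, hy, hxy⟩ := this
    rwa [hR1 x y hy hxy]
  · have : (1 : ℝ) / 2 < f y y := by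
      rw [hf1']
      norm_num
    filter_upwards [(f y).continuous.continuousAt.eventually_const_lt this] with x hx
      using hR1 x y hy hx.le
  · have h1 : shift x j = 0 := Finset.sum_eq_zero fun y hy ↦ by
      rw [hx j hj, hs hy j hj]
      simp
    simp only [R]
    rw [h1, mul_zero, add_zero, hx j hj]
    exact Set.projIcc_val zero_le_one _

/-- The contraction of a neighbourhood of `μ₀`, supported on `s`, first moves the mass near the points
of `s` into these points while the mass elsewhere goes to the centre, and then interpolates linearly
between measures on `s`. The linear phase stays in `Pf` since nearby measures have at least as many
atoms as `μ₀`, hence satisfy the mass condition for the number of points of `s`. -/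
theorem hasLocalContractions_PfFace (n : ℕ) : HasLocalContractions (PfFace n) := by
  classical
  rintro ⟨μ₀, hμ₀⟩
  obtain ⟨s', hs'n, hs'A, hs'c⟩ := hμ₀
  obtain ⟨s, hss, hsc, hspos⟩ := hs'c.exists_exact
  have hsn : s.card ≤ n := (Finset.card_le_card hss).trans hs'n
  have hsA : (s : Set Cube) ⊆ face n := fun x hx ↦ hs'A (hss hx)
  obtain ⟨R, η, hR, hη, hR0, hRs, hηs, hηR, hRev, hRf⟩ := exists_clustering s
  -- the two phases of the contraction: `a` moves and discards mass, `b` adjusts the weights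
  let a : ℝ → unitInterval := fun t ↦ Set.projIcc 0 1 zero_le_one (2 * t)
  let b : ℝ → unitInterval := fun t ↦ Set.projIcc 0 1 zero_le_one (2 * t - 1)
  have ha : Continuous a := continuous_projIcc.comp (by fun_prop)
  have hb : Continuous b := continuous_projIcc.comp (by fun_prop)
  have hab : ∀ t, b t ≠ 0 → a t = 1 := fun t ht ↦ by
    refine Set.projIcc_of_right_le _ ?_
    by_contra! h
    exact ht (Set.projIcc_of_le_left _ (by linarith))
  let ηt : unitInterval → Cube → unitInterval := fun r x ↦
    unitInterval.symm (r * unitInterval.symm (η x))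
  have hηt : Continuous (Function.uncurry ηt) := by
    have : Continuous fun p : unitInterval × Cube ↦
      unitInterval.symm (p.1 * unitInterval.symm (η p.2)) := by fun_prop
    exact this
  let m : Pf Cube → ℝ → Pf Cube := fun ν t ↦ Pf.mix ν (ηt (a t)) (R (a t))
  have hm : Continuous (Function.uncurry m) := by
    have h1 : Continuous fun p : (Pf Cube × ℝ) × Cube ↦ (a p.1.2, p.2) := by fun_prop
    refine Pf.continuous_mix (P := Pf Cube × ℝ) (F := fun p ↦ p.1)
      (η := fun p ↦ ηt (a p.2)) (ρ := fun p ↦ R (a p.2)) continuous_fst (hηt.comp h1)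
      (fun φ ↦ ?_) ?_
    · exact (continuous_subtype_val.comp (hηt.comp h1)).mul (φ.continuous.comp (hR.comp h1))
    · exact hR.comp ((ha.comp continuous_snd).prodMk (Pf.continuous_ctr.comp continuous_fst))
  let V : Set (PfFace n) := {ν | R 1 (Pf.ctr ν.1) = Pf.ctr μ₀ ∧ s.card ≤ (Pf.supp ν.1).card}
  have hV : V ∈ 𝓝 (⟨μ₀, s', hs'n, hs'A, hs'c⟩ : PfFace n) := by
    have hcont : Continuous fun ν : PfFace n ↦ ν.1 := continuous_subtype_val
    have hctr : Filter.Tendsto (fun ν : PfFace n ↦ Pf.ctr ν.1)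
        (𝓝 (⟨μ₀, s', hs'n, hs'A, hs'c⟩ : PfFace n)) (𝓝 (Pf.ctr μ₀)) :=
      (Pf.continuous_ctr.comp hcont).tendsto _
    exact Filter.inter_mem (hctr.eventually (hRev _ hsc.mem))
      (hcont.continuousAt.eventually (Pf.eventually_card_le hspos))
  have hex : ∀ (ν : PfFace n) (t : ℝ), ∃ κ : PfFace n, ν ∈ V → ∀ φ : Cube → ℝ,
      ∫ x, φ x ∂(κ.1.1 : Measure Cube) = (1 - b t) * ∫ x, φ x ∂((m ν.1 t).1 : Measure Cube) +
        b t * ∫ x, φ x ∂(μ₀.1 : Measure Cube) := by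
    intro ν t
    by_cases hν : ν ∈ V
    swap
    · exact ⟨ν, fun h ↦ absurd h hν⟩
    by_cases hbt : b t = 0
    · exact ⟨⟨m ν.1 t, Pf.mix_mem_PfOn ν.2 _ (hRf n hsA _)⟩, fun _ φ ↦ by simp [hbt]⟩
    · have hat := hab t hbt
      have hmint : ∀ φ : Cube → ℝ, ∫ y, φ y ∂((m ν.1 t).1 : Measure Cube) =
          ∫ x, ((η x : ℝ) * φ (R 1 x) + (1 - η x) * φ (R 1 (Pf.ctr ν.1)))
            ∂(ν.1.1 : Measure Cube) := fun φ ↦ by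
        simp only [m]
        rw [Pf.integral_mix, hat]
        simp [ηt]
      have hcar : IsCarrier (m ν.1 t).1 s (Pf.ctr μ₀) := by
        refine ⟨?_, hsc.mem, ?_⟩
        · apply real_eq_zero_of_integral
          rw [hmint, integral_eq_sum_of_null (Pf.isCarrier ν.1).null]
          refine Finset.sum_eq_zero fun x _ ↦ ?_
          have h1 : R 1 (Pf.ctr ν.1) ∉ (s : Set Cube)ᶜ := by
            rw [hν.1]
            exact fun h ↦ h hsc.mem
          rw [Set.indicator_of_notMem h1]
          by_cases hx : η x = 0
          · simp [hx]
          · have h2 : R 1 x ∉ (s : Set Cube)ᶜ := fun h ↦ h (hηR x hx)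
            rw [Set.indicator_of_notMem h2]
            simp
        · rw [← hν.1]
          exact (one_sub_le_of_card_le hν.2).trans ((Pf.isCarrier ν.1).le.trans
            (real_singleton_le_of_integral_eq (Pf.isCarrier ν.1) hmint))
      obtain ⟨κ, hκ, hκint⟩ := hcar.exists_combination hsc (b t)
      exact ⟨⟨⟨κ, mem_Pf_iff.2 ⟨_, _, hκ⟩⟩, mem_PfOn_of_isCarrier hκ hsn hsA⟩, fun _ ↦ hκint⟩
  choose H hH using hex
  have hext : ∀ {κ κ' : PfFace n}, (∀ φ : Cube → ℝ, ∫ x, φ x ∂(κ.1.1 : Measure Cube) =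
      ∫ x, φ x ∂(κ'.1.1 : Measure Cube)) → κ = κ' := fun h ↦
    Subtype.ext (Subtype.ext (ext_of_forall_integral_eq h))
  refine ⟨V, hV, H, ?_, fun ν hν ↦ hext fun φ ↦ ?_, fun ν hν ↦ hext fun φ ↦ ?_,
    fun t ↦ hext fun φ ↦ ?_⟩
  · rw [continuousOn_iff_continuous_domRestrict]
    refine continuous_induced_rng.2 (Pf.continuous_iff.2 fun φ ↦ ?_)
    have h1 : Continuous fun p : (V ×ˢ (Set.univ : Set ℝ) : Set (PfFace n × ℝ)) ↦
        ∫ x, φ x ∂((m p.1.1.1 p.1.2).1 : Measure Cube) :=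
      Pf.continuous_iff.1 (hm.comp (by fun_prop :
        Continuous fun p : (V ×ˢ (Set.univ : Set ℝ) : Set (PfFace n × ℝ)) ↦
          (p.1.1.1, p.1.2))) φ
    have h2 : Continuous fun p : (V ×ˢ (Set.univ : Set ℝ) : Set (PfFace n × ℝ)) ↦
        (1 - (b p.1.2 : ℝ)) * ∫ x, φ x ∂((m p.1.1.1 p.1.2).1 : Measure Cube) +
        b p.1.2 * ∫ x, φ x ∂(μ₀.1 : Measure Cube) := by fun_prop
    exact h2.congr fun p ↦ (hH p.1.1 p.1.2 p.2.1 φ).symm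
  · have h0 : a 0 = 0 := Set.projIcc_of_le_left _ (by norm_num)
    have h1 : b 0 = 0 := Set.projIcc_of_le_left _ (by norm_num)
    have h2 : m ν.1 0 = ν.1 := Pf.mix_eq_self (Pf.isCarrier ν.1).null
      (fun x _ ↦ by simp [ηt, h0]) fun x _ ↦ by rw [h0, hR0]
    rw [hH ν 0 hν, h1, h2]
    simp
  · have h1 : b 1 = 1 := Set.projIcc_of_right_le _ (by norm_num)
    rw [hH ν 1 hν, h1]
    simp
  · have h2 : m μ₀ t = μ₀ := Pf.mix_eq_self hsc.null
      (fun x hx ↦ by simp [ηt, hηs x hx]) fun x hx ↦ hRs x hx _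
    rw [hH _ t (mem_of_mem_nhds hV)]
    simp only [h2]
    ring

theorem isAE_PfFace.{u} {n : ℕ} (hn : 1 ≤ n) : IsAE.{u} (PfFace n) := by
  obtain ⟨N, e, he, hinj⟩ := exists_embedding_PfFace n
  have := contractibleSpace_PfFace hn
  exact (isANE_of_hasLocalContractions (hasLocalContractions_PfFace n) he
    hinj).isAE_of_contractibleSpace

/-- A bounded continuous metric on the Hilbert cube. -/
theorem exists_distance : ∃ D : Cube → Cube → ℝ, Continuous (Function.uncurry D) ∧
    (∀ x y, D x y ∈ Set.Icc (0 : ℝ) 1) ∧ (∀ x, D x x = 0) ∧ ∀ x y, D x y = 0 → x = y := by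
  let := TopologicalSpace.metrizableSpaceMetric Cube
  refine ⟨fun x y ↦ min 1 (dist x y), ?_, fun x y ↦
    ⟨le_min zero_le_one dist_nonneg, min_le_left _ _⟩, fun x ↦ by simp, fun x y h ↦ ?_⟩
  · have : Continuous fun p : Cube × Cube ↦ min 1 (dist p.1 p.2) := by fun_prop
    exact this
  · change min 1 (dist x y) = 0 at h
    rcases min_choice 1 (dist x y) with h1 | h1
    · rw [h1] at h
      exact absurd h one_ne_zero
    · rw [h1] at h
      exact dist_eq_zero.1 h

/-- A homotopy of `Pf Cube` into the finite-dimensional pieces. The points are moved into faces, and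
a part of the mass is moved to the centre: with `e μ` the mean distance from the centre, all of it
if `e μ ≤ s`. If `e μ > s`, then the mass off the centre is at least `s`, and the definition of `Pf`
bounds the number of points by `1 / s`. -/
theorem exists_homotopy_Pf_cube : ∃ h : ℝ → Pf Cube → Pf Cube, Continuous (Function.uncurry h) ∧
    (∀ μ, h 0 μ = μ) ∧ ∀ (k : ℕ) s μ, (1 / 2 : ℝ) ^ k ≤ s → h s μ ∈ PfFace (2 ^ (k + 1)) := by
  classical
  obtain ⟨D, hD, hD1, hDself, hDeq⟩ := exists_distance
  let e : Pf Cube → ℝ := fun μ ↦ ∫ x, D x (Pf.ctr μ) ∂(μ.1 : Measure Cube)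
  have he : Continuous e := by
    refine continuous_integral_param (F := id) continuous_id
      (ψ := fun μ x ↦ D x (Pf.ctr μ)) ?_
    have h1 : Continuous fun p : Pf Cube × Cube ↦ (p.2, Pf.ctr p.1) :=
      continuous_snd.prodMk (Pf.continuous_ctr.comp continuous_fst)
    exact hD.comp h1
  have he0 : ∀ μ, 0 ≤ e μ := fun μ ↦ integral_nonneg fun x ↦ (hD1 _ _).1
  have hezero : ∀ μ, e μ = 0 → ∀ x, 0 < (μ.1 : Measure Cube).real {x} → x = Pf.ctr μ := by
    intro μ hμ x hx
    have h1 := Pf.mul_le_integral μ x (f := fun x ↦ D x (Pf.ctr μ)) fun x ↦ (hD1 _ _).1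
    change _ ≤ e μ at h1
    rw [hμ] at h1
    refine hDeq _ _ (le_antisymm ?_ (hD1 _ _).1)
    exact nonpos_of_mul_nonpos_right h1 hx
  have hemass : ∀ μ, e μ ≤ 1 - (μ.1 : Measure Cube).real {Pf.ctr μ} := by
    intro μ
    have h1 := Pf.abs_integral_sub_le μ (f := fun x ↦ D x (Pf.ctr μ)) (C := 1) fun x ↦ by
      rw [hDself, sub_zero, abs_of_nonneg (hD1 _ _).1]
      exact (hD1 _ _).2
    rw [hDself, sub_zero, mul_one] at h1
    exact (le_abs_self _).trans h1
  -- if `e μ = 0`, then `μ` is a point mass, and the value of `c`, with `s / 0 = 0`, does not matter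
  let c : ℝ → Pf Cube → unitInterval := fun s μ ↦ Set.projIcc 0 1 zero_le_one (1 - s / e μ)
  let ρ : ℝ → Cube → Cube := fun s x j ↦
    Set.projIcc 0 1 zero_le_one (2 - ((j : ℝ) + 1) * s) * x j
  have hρ : Continuous (Function.uncurry ρ) := by
    refine continuous_pi fun j ↦ ?_
    have h1 : Continuous fun p : ℝ × Cube ↦
        Set.projIcc (0 : ℝ) 1 zero_le_one (2 - ((j : ℝ) + 1) * p.1) :=
      continuous_projIcc.comp (by fun_prop)
    exact h1.mul ((continuous_apply j).comp continuous_snd)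
  let h : ℝ → Pf Cube → Pf Cube := fun s μ ↦ Pf.mix μ (fun _ ↦ c s μ) (ρ s)
  refine ⟨h, ?_, fun μ ↦ ?_, fun k s μ hs ↦ ?_⟩
  · refine Pf.continuous_iff.2 fun φ ↦ ?_
    let B : ℝ × Pf Cube → ℝ := fun p ↦
      ∫ x, (φ (ρ p.1 x) - φ (ρ p.1 (Pf.ctr p.2))) ∂(p.2.1 : Measure Cube)
    have hA : Continuous fun p : ℝ × Pf Cube ↦ φ (ρ p.1 (Pf.ctr p.2)) :=
      φ.continuous.comp (hρ.comp (continuous_fst.prodMk (Pf.continuous_ctr.comp continuous_snd)))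
    have hB : Continuous B := by
      refine continuous_integral_param (F := fun p : ℝ × Pf Cube ↦ p.2) continuous_snd
        (ψ := fun p x ↦ φ (ρ p.1 x) - φ (ρ p.1 (Pf.ctr p.2))) ?_
      have h1 : Continuous fun p : (ℝ × Pf Cube) × Cube ↦ φ (ρ p.1.1 p.2) :=
        φ.continuous.comp (hρ.comp (by fun_prop :
          Continuous fun p : (ℝ × Pf Cube) × Cube ↦ (p.1.1, p.2)))
      exact h1.sub (hA.comp continuous_fst)
    have hint : ∀ p : ℝ × Pf Cube, ∫ x, φ x ∂((h p.1 p.2).1 : Measure Cube) =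
        φ (ρ p.1 (Pf.ctr p.2)) + c p.1 p.2 * B p := by
      intro p
      have hn := (Pf.isCarrier p.2).null
      simp only [h, B]
      rw [Pf.integral_mix, integral_eq_sum_of_null hn, integral_eq_sum_of_null hn, Finset.mul_sum]
      have h1 := sum_real_singleton_of_null hn
      calc _ = ∑ x ∈ Pf.supp p.2, ((p.2.1 : Measure Cube).real {x} * φ (ρ p.1 (Pf.ctr p.2)) +
            c p.1 p.2 * ((p.2.1 : Measure Cube).real {x} *
              (φ (ρ p.1 x) - φ (ρ p.1 (Pf.ctr p.2))))) :=
            Finset.sum_congr rfl fun x _ ↦ by ring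
        _ = _ := by rw [Finset.sum_add_distrib, ← Finset.sum_mul, h1, one_mul]
    have hcB : Continuous fun p : ℝ × Pf Cube ↦ (c p.1 p.2 : ℝ) * B p := by
      rw [continuous_iff_continuousAt]
      rintro ⟨s, μ⟩
      by_cases hμ : e μ = 0
      · -- `c` may jump here, but `B` vanishes and `c` is bounded
        have hB0 : B (s, μ) = 0 := by
          simp only [B]
          rw [integral_eq_sum_of_null (Pf.isCarrier μ).null]
          refine Finset.sum_eq_zero fun x _ ↦ ?_
          rcases (measureReal_nonneg (μ := (μ.1 : Measure Cube)) (s := {x})).eq_or_lt with h1 | h1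
          · rw [← h1, zero_mul]
          · rw [hezero μ hμ x h1, sub_self, mul_zero]
        rw [ContinuousAt, hB0, mul_zero]
        have h2 : Filter.Tendsto (fun p ↦ ‖B p‖) (𝓝 (s, μ)) (𝓝 0) := by
          have := (hB.norm).tendsto (s, μ)
          rwa [hB0, norm_zero] at this
        refine squeeze_zero_norm (fun p ↦ ?_) h2
        rw [norm_mul]
        refine mul_le_of_le_one_left (norm_nonneg _) ?_
        rw [Real.norm_of_nonneg (c p.1 p.2).2.1]
        exact (c p.1 p.2).2.2
      · refine ContinuousAt.mul ?_ hB.continuousAt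
        refine (continuous_subtype_val.comp continuous_projIcc).continuousAt.comp
          (f := fun p : ℝ × Pf Cube ↦ 1 - p.1 / e p.2) ?_
        exact continuousAt_const.sub (continuous_fst.continuousAt.div
          (he.comp continuous_snd).continuousAt hμ)
    exact (hA.add hcB).congr fun p ↦ (hint p).symm
  · refine Pf.mix_eq_self (Pf.isCarrier μ).null (fun x _ ↦ ?_) fun x _ ↦ ?_
    · exact Set.projIcc_of_right_le _ (by simp)
    · funext j
      simp only [ρ, mul_zero, sub_zero]
      rw [Set.projIcc_of_right_le _ (by norm_num)]
      exact one_mul _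
  · have hpow : (0 : ℝ) < (1 / 2) ^ k := by positivity
    have hspos : 0 < s := hpow.trans_le hs
    have h2s : 1 ≤ (2 : ℝ) ^ k * s := by
      calc (1 : ℝ) = 2 ^ k * (1 / 2) ^ k := by rw [← mul_pow]; norm_num
        _ ≤ 2 ^ k * s := by gcongr
    have hface : ∀ x, ρ s x ∈ face (2 ^ (k + 1)) := by
      intro x j hj
      have hj' : (2 : ℝ) ^ (k + 1) ≤ j := by exact_mod_cast hj
      simp only [ρ]
      rw [Set.projIcc_of_le_left _ (by rw [pow_succ] at hj'; nlinarith)]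
      exact zero_mul _
    have hone : 1 ≤ 2 ^ (k + 1) := Nat.one_le_two_pow
    obtain ⟨t, -, ht, htpos⟩ := (Pf.isCarrier μ).exists_exact
    by_cases hcase : 0 < e μ ∧ e μ ≤ s
    · -- all the mass is moved to the centre
      have hc0 : c s μ = 0 := Set.projIcc_of_le_left _ (by
        rw [sub_nonpos, one_le_div hcase.1]
        exact hcase.2)
      have : h s μ = Pf.dirac (ρ s (Pf.ctr μ)) :=
        Subtype.ext (ext_of_forall_integral_eq fun φ ↦ by
          simp only [h]
          rw [Pf.integral_mix, Pf.integral_dirac, hc0]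
          simp)
      rw [this]
      exact Pf.dirac_mem_PfOn (hface _) hone
    · have hcard : t.card ≤ 2 ^ (k + 1) := by
        by_cases hμ : e μ = 0
        · have : t ⊆ {Pf.ctr μ} := fun x hx ↦ by simpa using hezero μ hμ x (htpos x hx)
          exact (Finset.card_le_card this).trans (by simpa using hone)
        · have hlt : s < e μ := by
            by_contra! hle
            exact hcase ⟨lt_of_le_of_ne (he0 μ) (Ne.symm hμ), hle⟩
          have h1 := hemass μ
          have h3 := ht.le
          have h4 : s < 1 / ((t.card : ℝ) + 1) := by linarith
          rw [lt_div_iff₀ (by positivity)] at h4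
          have h5 : (t.card : ℝ) + 1 < 2 ^ k := by nlinarith
          have h6 : t.card + 1 < 2 ^ k := by exact_mod_cast h5
          rw [pow_succ]
          omega
      exact Pf.mix_mem_PfOn (A := Set.univ) ⟨t, hcard, Set.subset_univ _, ht⟩ _
        fun x _ ↦ hface x

theorem isAE_Pf_cube.{u} : IsAE.{u} (Pf Cube) := by
  obtain ⟨h, hc, h0, hs⟩ := exists_homotopy_Pf_cube
  refine isAE_of_homotopy (S := fun k ↦ PfFace (2 ^ (k + 1))) (fun i j hij ↦ ?_)
    (fun k ↦ isAE_PfFace Nat.one_le_two_pow) hc h0 hs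
  have : 2 ^ (i + 1) ≤ 2 ^ (j + 1) := Nat.pow_le_pow_right (by norm_num) (by omega)
  exact PfOn_mono (face_mono this) this

/-! ### Transfer between `X` and `Pf X` -/

/-- Embed `X` in the cube, with a retraction `g` of a neighbourhood `U`. A map into `Pf X` is extended
as a map into `Pf Cube`, and where the centre is in `U` it is brought back to `Pf X` by `g`, after the
mass lying outside `U` has been moved to the centre with a cut-off function `η`. -/
theorem isANE_Pf.{u} {X : Type u} [TopologicalSpace X] [CompactSpace X] [T2Space X]
    [MeasurableSpace X] [BorelSpace X] [TopologicalSpace.MetrizableSpace X] (h : IsANE.{u} X) :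
    IsANE.{u} (Pf X) := by
  classical
  rcases isEmpty_or_nonempty X with hX | hX
  · intro Y _ _ A _ f _
    have : IsEmpty Y := ⟨fun y ↦ hX.elim (Pf.ctr (f y))⟩
    exact ⟨Set.univ, isOpen_univ, Set.subset_univ _, f, continuous_of_const
      (fun y ↦ this.elim y) |>.continuousOn, fun _ _ ↦ rfl⟩
  let := TopologicalSpace.metrizableSpaceMetric X
  obtain ⟨i, hi⟩ := Metric.PiNatEmbed.exists_embedding_to_hilbert_cube (X := X)
  have hic : IsClosedEmbedding i := hi.continuous.isClosedEmbedding hi.injective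
  have hinv : ∀ x, Function.invFun i (i x) = x := Function.leftInverse_invFun hi.injective
  -- a retraction `g` of a neighbourhood `U` of `X` in the cube
  have hmet : TopologicalSpace.MetrizableSpace (ULift.{u} Cube) :=
    Homeomorph.ulift.isEmbedding.metrizableSpace
  obtain ⟨U', hU', hAU', g', hg', hgi'⟩ := h (ULift.{u} Cube) (ULift.down ⁻¹' Set.range i)
    (hic.isClosed_range.preimage continuous_uliftDown) (fun y ↦ Function.invFun i y.down) (by
      rw [hi.continuousOn_iff]
      exact continuous_uliftDown.continuousOn.congr fun y hy ↦ Function.invFun_eq hy)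
  let U : Set Cube := ULift.up ⁻¹' U'
  let g : Cube → X := fun y ↦ g' ⟨y⟩
  have hU : IsOpen U := hU'.preimage continuous_uliftUp
  have hg : ContinuousOn g U := hg'.comp continuous_uliftUp.continuousOn fun y hy ↦ hy
  have hAU : Set.range i ⊆ U := fun y hy ↦ hAU' hy
  have hgi : ∀ x, g (i x) = x := fun x ↦ (hgi' (x := ⟨i x⟩) ⟨x, rfl⟩).trans (hinv x)
  obtain ⟨V, hV, hAV, hVU⟩ := normal_exists_closure_subset hic.isClosed_range hU hAU
  obtain ⟨u, hu0, hu1, hu⟩ := exists_continuous_zero_one_of_isClosed hV.isClosed_compl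
    hic.isClosed_range (Set.disjoint_left.2 fun y hy hy' ↦ hy (hAV hy'))
  let η : Cube → unitInterval := fun y ↦ ⟨u y, hu y⟩
  have hη : Continuous η := by fun_prop
  have hηi : ∀ x, η (i x) = 1 := fun x ↦ Subtype.ext (hu1 ⟨x, rfl⟩)
  have hηg : ∀ φ : C(X, ℝ), Continuous fun y ↦ (η y : ℝ) * φ (g y) := by
    intro φ
    rw [continuous_iff_continuousAt]
    intro y
    by_cases hy : y ∈ U
    · exact (continuous_subtype_val.comp hη).continuousAt.mul
        (φ.continuous.continuousAt.comp (hg.continuousAt (hU.mem_nhds hy)))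
    · refine (continuousAt_const (y := (0 : ℝ))).congr ?_
      filter_upwards [isClosed_closure.isOpen_compl.mem_nhds fun h' ↦ hy (hVU h')] with x hx
      have : u x = 0 := hu0 fun h' ↦ hx (subset_closure h')
      simp [η, this]
  -- the image of a measure on `X` in the cube
  let push : Pf X → Pf Cube := fun μ ↦ Pf.mix μ (fun _ ↦ 1) i
  have hpush : Continuous push := by
    refine Pf.continuous_mix (F := id) (η := fun _ _ ↦ 1) (ρ := fun _ ↦ i) continuous_id
      continuous_const (fun φ ↦ ?_) (hi.continuous.comp Pf.continuous_ctr)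
    exact continuous_const.mul (φ.continuous.comp (hi.continuous.comp continuous_snd))
  intro Y _ _ A hA f hf
  obtain ⟨F, hF, hFf⟩ := isAE_Pf_cube Y A hA (fun y ↦ push (f y)) (hpush.comp_continuousOn hf)
  have hctr : Continuous fun y ↦ Pf.ctr (F y) := Pf.continuous_ctr.comp hF
  refine ⟨{y | Pf.ctr (F y) ∈ U}, hU.preimage hctr, fun y hy ↦ ?_,
    fun y ↦ Pf.mix (F y) η g, ?_, fun y hy ↦ ?_⟩
  · change Pf.ctr (F y) ∈ U
    rw [hFf hy, Pf.ctr_mix]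
    exact hAU ⟨_, rfl⟩
  · rw [continuousOn_iff_continuous_domRestrict]
    refine Pf.continuous_mix (P := {y | Pf.ctr (F y) ∈ U}) (F := fun y ↦ F y)
      (η := fun _ ↦ η) (ρ := fun _ ↦ g) (hF.comp continuous_subtype_val)
      (hη.comp continuous_snd) (fun φ ↦ (hηg φ).comp continuous_snd) ?_
    exact hg.comp_continuous (hctr.comp continuous_subtype_val) fun y ↦ y.2
  · refine Subtype.ext (ext_of_forall_integral_eq fun φ ↦ ?_)
    simp only [hFf hy, push]
    rw [Pf.integral_mix, Pf.integral_mix]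
    simp [hηi, hgi]

theorem corollary2 {X : Type*} [TopologicalSpace X] [CompactSpace X] [T2Space X]
    [MeasurableSpace X] [BorelSpace X] :
    IsANR (Pf X) ↔ IsANR X := by
  constructor
  · intro h
    have hmet := h.1
    have hANE := h.isANE_of_compactSpace
    have : TopologicalSpace.MetrizableSpace X :=
      (Function.LeftInverse.isEmbedding (f := Pf.ctr) (g := Pf.dirac) Pf.ctr_dirac
        Pf.continuous_ctr Pf.continuous_dirac).metrizableSpace
    refine IsANE.isANR fun Y _ _ A hA f hf ↦ ?_
    obtain ⟨U, hU, hAU, g, hg, hgf⟩ := hANE Y A hA (fun y ↦ Pf.dirac (f y))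
      (Pf.continuous_dirac.comp_continuousOn hf)
    exact ⟨U, hU, hAU, fun y ↦ Pf.ctr (g y), Pf.continuous_ctr.comp_continuousOn hg,
      fun y hy ↦ by simp only [hgf hy, Pf.ctr_dirac]⟩
  · intro h
    have hmet := h.1
    let := TopologicalSpace.metrizableSpaceMetric X
    exact (isANE_Pf h.isANE_of_compactSpace).isANR
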